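/- Conventions. $X,Y$ are Banach spaces over $\mathbb K\in\{\mathbb R,\mathbb C\}$, $B_X$ is the closed unit ball, an operator is a bounded linear map, and $\xi$ is an ordinal. For $K\subset X^*$ and $\varepsilon>0$, $s_\varepsilon(K)$ is the set of $x^*\in K$ such that the norm-diameter of $V\cap K$ exceeds $\varepsilon$ for every $w^*$-neighborhood $V$ of $x^*$. Its transfinite iterates are $s^0_\varepsilon(K)=K$, $s_\varepsilon^{\zeta+1}(K)=s_\varepsilon(s_\varepsilon^\zeta(K))$, and intersections at limit ordinals. Put $s_{\xi,\varepsilon}=s_\varepsilon^{\omega^\xi}$, iterate it in the same way, and for $A:X\to Y$ let $Sz_\xi(A,\varepsilon)$ be the least ordinal $\beta$ with $s_{\xi,\varepsilon}^\beta(A^*B_{Y^*})=\varnothing$ ($\infty$ if there is none; in the supremum below, infinite values count as $\infty$). For sequences, $\preceq$ denotes the initial segment order, $\frown$ concatenation, $MAX(S)$ the set of $\preceq$-maximal members of $S$, and $\zeta+(\zeta_i)_i=(\zeta+\zeta_i)_i$. Define sets of finite sequences of ordinals by $\Gamma_0=\{(0)\}$; $\Gamma_{\xi,1}=\Gamma_\xi$,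 $\Gamma_{\xi,n+1}=(\omega^\xi n+\Gamma_\xi)\cup\{t\frown u: t\in MAX(\omega^\xi n+\Gamma_\xi),\,u\in\Gamma_{\xi,n}\}$; $\Gamma_{\xi+1}=\bigcup_{n\ge1}\Gamma_{\xi,n}$; and $\Gamma_\xi=\bigcup_{\zeta<\xi}(\omega^\zeta+\Gamma_{\zeta+1})$ for limit $\xi$. Each $t\in\Gamma_{\xi,n}$ is uniquely of the form $(\omega^\xi(n-1)+t_1)\frown\cdots\frown(\omega^\xi(n-m)+t_m)$ with $1\le m\le n$, $t_i\in\Gamma_\xi$, and $t_i\in MAX(\Gamma_\xi)$ for $i<m$; we say that $t$ is on level $m$ and put $\iota_{\xi,n}(t)=t_m$. Let $\mathbb P_0=1$ on $\Gamma_0$, $\mathbb P_{\xi+1}(t)=\frac1n\mathbb P_\xi(\iota_{\xi,n}(t))$ for $t\in\Gamma_{\xi,n}$, and, for limit $\xi$, $\mathbb P_\xi(\omega^\zeta+t)=\mathbb P_{\zeta+1}(t)$ for $\zeta<\xi$, $t\in\Gamma_{\zeta+1}$. Let $D$ be a neighborhood basis at $0$ for the weak topology of $X$, and let $\Omega_{\xi,n}$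 be the set of all sequences $(\zeta_i,U_i)_{i=1}^k$ with $(\zeta_i)_{i=1}^k\in\Gamma_{\xi,n}$ and $U_i\in D$; levels, $\iota_{\xi,n}$ and $\mathbb P_\xi$ are applied to such sequences through their ordinal coordinates. A collection $(x_t)_{t\in\Omega_{\xi,n}}\subset X$ is normally weakly null if $x_t\in U$ whenever the last entry of $t$ is $(\zeta,U)$. For $t\in MAX(\Omega_{\xi,n})$ and $1\le i\le n$, let $z_i^t=\sum\mathbb P_\xi(\iota_{\xi,n}(s))\,x_s$, the sum over all $s\preceq t$ on level $i$. Theorem. Let $1\le p<\infty$, $1/p+1/q=1$ (so $q=\infty$ if $p=1$), $1<r<q$ and $0\le\alpha<\infty$. There is a constant $\beta=\beta(\alpha,p,r)$ such that the following holds for all Banach spaces $X,Y$, every ordinal $\xi$, every operator $A:X\to Y$ with $\|A\|\le1$ and $\sup_{0<\varepsilon\le1}\varepsilon^pSz_\xi(A,\varepsilon)=\alpha$, and every weak neighborhood basis $D$ at $0$ in $X$. For every $n\ge1$, all positive scalars $(a_i)_{i=1}^n$, and every normally weakly null $(x_t)_{t\in\Omega_{\xi,n}}\subset B_X$, $$\inf_{t\in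 MAX(\Omega_{\xi,n})}\Bigl\|\sum_{i=1}^n a_i\,A z_i^t\Bigr\|\le\beta\Bigl(\sum_{i=1}^n a_i^r\Bigr)^{1/r}.$$ -/

import Mathlib

open scoped ENNReal NNReal Topology

universe w

namespace XiSzlenk

noncomputable section

/-! ### Trees of finite sequences

A finite sequence is a list, and `s <+: t` says that `s` is an initial segment of `t`. -/

/-- `MAX S`: the members of `S` that have no proper extension in `S`. -/
def maxMembers {Λ : Type*} (S : Set (List Λ)) : Set (List Λ) :=
  {t | t ∈ S ∧ ∀ s ∈ S, t <+: s → s = t}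

/-- `ζ + S`, where `ζ + (ζ₁, …, ζₖ) = (ζ + ζ₁, …, ζ + ζₖ)`. -/
def shift (ζ : Ordinal) (S : Set (List Ordinal)) : Set (List Ordinal) :=
  (fun t => t.map (fun η => ζ + η)) '' S

/-- With `a = ω ^ ξ` and `S = Γ_ξ` this is `Γ_{ξ, n}`: the set for `n + 1` consists of `a n + S` and
of all `t ⌢ u` with `t ∈ MAX (a n + S)` and `u` in the set for `n`. For `n = 0` it is empty, so for
`n = 1` it is `S`. -/
def stack (a : Ordinal) (S : Set (List Ordinal)) : ℕ → Set (List Ordinal)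
  | 0 => ∅
  | n + 1 => shift (a * n) S ∪
      {v | ∃ t ∈ maxMembers (shift (a * n) S), ∃ u ∈ stack a S n, v = t ++ u}

/-- The `B`-trees `Γ_ξ`: `Γ_0 = {(0)}`, `Γ_{ξ+1} = ⋃ₙ Γ_{ξ, n}`, and
`Γ_ξ = ⋃_{ζ < ξ} (ω ^ ζ + Γ_{ζ+1})` for a limit ordinal `ξ`. -/
def Gam (ξ : Ordinal) : Set (List Ordinal) :=
  Ordinal.limitRecOn (motive := fun _ => Set (List Ordinal)) ξ {[0]}
    (fun ζ S => ⋃ n : ℕ, stack (Ordinal.omega0 ^ ζ) S n)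
    (fun _ hξ ih => ⋃ ζ, ⋃ h, shift (Ordinal.omega0 ^ ζ) (ih (ζ + 1) (hξ.add_one_lt h)))

/-- The `B`-trees `Γ_{ξ, n}`. -/
def GamN (ξ : Ordinal) (n : ℕ) : Set (List Ordinal) := stack (Ordinal.omega0 ^ ξ) (Gam ξ) n

/-- The `m`-th level of `Γ_{ξ, n}`, for `1 ≤ m ≤ n`. As the entries of members of `Γ_ξ` are less
than `ω ^ ξ`, a member `(ω^ξ (n-1) + t₁) ⌢ … ⌢ (ω^ξ (n-m) + tₘ)` of `Γ_{ξ, n}`, where all `tᵢ ∈ Γ_ξ`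
and `tᵢ` is maximal for `i < m`, is recognized by its last entry, which has quotient `n - m` in
the Euclidean division by `ω ^ ξ`. -/
def level (ξ : Ordinal) (n m : ℕ) : Set (List Ordinal) :=
  {t | t ∈ GamN ξ n ∧ t.getLastD 0 / Ordinal.omega0 ^ ξ + m = n}

/-- The identification of each unit of `Γ_{ξ, n}` with `Γ_ξ`: it sends
`(ω^ξ (n-1) + t₁) ⌢ … ⌢ (ω^ξ (n-m) + tₘ)`, as above, to `tₘ`. The part `ω^ξ (n-m) + tₘ` consists of
those entries whose quotient by `ω ^ ξ` is that of the last entry, and the remainders of these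
entries form `tₘ`. -/
def unitPart (ξ : Ordinal) (t : List Ordinal) : List Ordinal :=
  (t.filter (fun η => η / Ordinal.omega0 ^ ξ = t.getLastD 0 / Ordinal.omega0 ^ ξ)).map
    (fun η => η % Ordinal.omega0 ^ ξ)

/-- The weights `ℙ_ξ` on `Γ_ξ` (they do not see the entries from the directed set):
* `ℙ_0 = 1`;
* `ℙ_{ξ+1} t = ℙ_ξ (unitPart ξ t) / n` for `t ∈ Γ_{ξ, n}`, where `n` is determined by `t`;
* for a limit ordinal `ξ`, `ℙ_ξ (ω ^ ζ + t') = ℙ_{ζ+1} t'` for `ζ < ξ` and `t' ∈ Γ_{ζ+1}`. The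
entries of `t = ω ^ ζ + t'` lie in `[ω ^ ζ, ω ^ (ζ+1))`, so `ζ` is the logarithm to base `ω` of the
first entry of `t`. -/
def weight (ξ : Ordinal) : List Ordinal → ℝ :=
  Ordinal.limitRecOn (motive := fun _ => List Ordinal → ℝ) ξ (fun _ => 1)
    (fun ζ P t => (1 / (sInf {n : ℕ | t ∈ GamN ζ n} : ℕ)) * P (unitPart ζ t))
    (fun ξ hξ P t =>
      open Classical in
      if h : Ordinal.log Ordinal.omega0 (t.headD 0) < ξ then
        P (Ordinal.log Ordinal.omega0 (t.headD 0) + 1) (hξ.add_one_lt h)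
          (t.map (fun η => η - Ordinal.omega0 ^ Ordinal.log Ordinal.omega0 (t.headD 0)))
      else 0)

/-- `Ω_{ξ, n} = Γ_{ξ, n} D`: the sequences of pairs whose first coordinates form a member of
`Γ_{ξ, n}` and whose second coordinates lie in `D`. -/
def Om (ξ : Ordinal) (n : ℕ) (D : Type*) : Set (List (Ordinal × D)) :=
  {t | t.map Prod.fst ∈ GamN ξ n}

section Spaces

variable (𝕜 : Type*) [RCLike 𝕜] {X Y : Type*} [NormedAddCommGroup X] [NormedSpace 𝕜 X]
  [NormedAddCommGroup Y] [NormedSpace 𝕜 Y]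

/-- `zᵢᵗ = ∑ ℙ_ξ(ι_{ξ, n}(s)) x_s`, the sum over all initial segments `s` of `t` that lie on level
`i` of `Ω_{ξ, n}`. -/
def convexBlock {D : Type*} (ξ : Ordinal) (n : ℕ) (x : List (Ordinal × D) → X)
    (t : List (Ordinal × D)) (i : ℕ) : X :=
  open Classical in
  ∑ k ∈ Finset.range t.length,
    if (t.take (k + 1)).map Prod.fst ∈ level ξ n i then
      (weight ξ (unitPart ξ ((t.take (k + 1)).map Prod.fst)) : 𝕜) • x (t.take (k + 1))
    else 0

/-- `D` is a basis of the neighborhoods of `0` for the weak topology of `X`. -/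
def IsWeakBasis (D : Set (Set X)) : Prop :=
  (Filter.comap (toWeakSpace 𝕜 X) (𝓝 0)).HasBasis (fun U => U ∈ D) id

/-- The collection `(x_t)_{t ∈ Ω_{ξ, n}}` is normally weakly null: `x_t ∈ U` whenever the last entry
of `t` is `(ζ, U)`. -/
def NormallyWeaklyNull (D : Set (Set X)) (ξ : Ordinal) (n : ℕ)
    (x : List (Ordinal × D) → X) : Prop :=
  ∀ (s : List (Ordinal × D)) (ζ : Ordinal) (U : D),
    s ++ [(ζ, U)] ∈ Om ξ n D → x (s ++ [(ζ, U)]) ∈ (U : Set X)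

variable {𝕜}

/-- The derivation `s_ε`: those `f ∈ K` such that `diam (V ∩ K) > ε` (in norm) for every
`w*`-neighborhood `V` of `f`; and `s_ε K = K` for `ε ≤ 0`. -/
def szlenkDeriv (ε : ℝ) (K : Set (StrongDual 𝕜 X)) : Set (StrongDual 𝕜 X) :=
  {f | f ∈ K ∧ (0 < ε → ∀ V ∈ 𝓝 (StrongDual.toWeakDual f),
    ENNReal.ofReal ε < Metric.ediam (StrongDual.toWeakDual ⁻¹' V ∩ K))}

/-- The transfinite iterates of a derivation `d`, starting with `K`. -/
def derivIter {E : Type*} (d : Set E → Set E) (K : Set E) (β : Ordinal.{w}) : Set E :=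
  Ordinal.limitRecOn (motive := fun _ => Set E) β K (fun _ L => d L)
    (fun _ _ ih => ⋂ ζ, ⋂ h, ih ζ h)

/-- `s_{ξ, ε} = s_ε ^ (ω ^ ξ)`. -/
def szlenkDerivXi (ξ : Ordinal.{w}) (ε : ℝ) (K : Set (StrongDual 𝕜 X)) : Set (StrongDual 𝕜 X) :=
  derivIter (szlenkDeriv ε) K (Ordinal.omega0 ^ ξ)

/-- `Sz_ξ(K, ε)`: the least `β` such that the `β`-th iterate of `s_{ξ, ε}` on `K` is empty, and `⊤`
if there is none. -/
def szlenkXi (ξ : Ordinal.{w}) (K : Set (StrongDual 𝕜 X)) (ε : ℝ) : WithTop Ordinal.{w} :=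
  open Classical in
  if ∃ β : Ordinal.{w}, derivIter (szlenkDerivXi ξ ε) K β = ∅ then
    ((sInf {β : Ordinal.{w} | derivIter (szlenkDerivXi ξ ε) K β = ∅} : Ordinal.{w}) :
      WithTop Ordinal.{w})
  else ⊤

/-- `A* B_{Y*}`. -/
def adjointBall (A : X →L[𝕜] Y) : Set (StrongDual 𝕜 X) :=
  {f | ∃ g : StrongDual 𝕜 Y, ‖g‖ ≤ 1 ∧ f = g.comp A}

/-- A natural number as itself, everything larger as `∞`. -/
def toENN (o : WithTop Ordinal.{w}) : ℝ≥0∞ :=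
  ⨅ (n : ℕ) (_ : o ≤ ((n : Ordinal.{w}) : WithTop Ordinal.{w})), (n : ℝ≥0∞)

/-- `sup_{0 < ε ≤ 1} ε ^ p Sz_ξ(A, ε)`, as an extended nonnegative number. -/
def szlenkPowerSup (p : ℝ) (ξ : Ordinal.{w}) (A : X →L[𝕜] Y) : ℝ≥0∞ :=
  ⨆ ε ∈ Set.Ioc (0 : ℝ) 1, ENNReal.ofReal (ε ^ p) * toENN (szlenkXi ξ (adjointBall A) ε)

end Spaces

end

end XiSzlenk

/-! Let `K = A* B_{Y*}`, a weak* compact set. If `I` is the infimum, every maximal `t` has a norming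
functional, whose image in `K` has real part at least `I` at `∑ aᵢ zᵢᵗ`. The levels of the tree are
removed one at a time, the last one first. Each removal replaces functionals by a weak* cluster
point, which lies in a derivative `s_{ξ, b}`, and costs at most `aᵢ bᵢ` plus a small error. In the
end some `y` lies in `s_{ξ, b₀}(s_{ξ, b₁}(⋯ K))` and `I - δ ≤ ∑ aᵢ bᵢ` (`stackEstimate`).

A nonempty mixed derivative forces `#{i : bᵢ ≥ ε} ≤ Sz_ξ(A, ε) ≤ α ε⁻ᵖ`, so `b` is bounded in weak
`ℓ_p`. It is therefore bounded in `ℓ_{r'}`, where `1/r + 1/r' = 1`, because `r < q` means `r' > p`.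
Hölder's inequality then bounds `∑ aᵢ bᵢ` (`sum_mul_le_upperConst`).

Removing one level is `unitEstimate`, by induction on `ξ`. For `ξ = 0`, weak nullity separates the
functionals from their cluster point. At `ξ + 1`, equal weights on `n` levels make the parameter an
average of `n` parameters. If the averages tend to `β > b`, the number of parameters above `b` is
unbounded, so the cluster point survives all finite iterates of `s_{ξ, b}`. At limits one passes to
the limit over `ζ < ξ`. Estimates are stated for finitely many compact sets at once, because the
parameters found on later levels depend on the branch and are rounded to a finite grid. -/

namespace XiSzlenk

/-! ### Combinatorics of the trees `Γ_ξ` and `Γ_{ξ, n}`. -/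

section Trees

variable {Λ : Type*}

theorem omega_opow_pos (ξ : Ordinal) : 0 < Ordinal.omega0 ^ ξ :=
  Ordinal.opow_pos _ Ordinal.omega0_pos

theorem omega_opow_ne_zero (ξ : Ordinal) : Ordinal.omega0 ^ ξ ≠ 0 := (omega_opow_pos ξ).ne'

theorem Gam_zero : Gam 0 = {[0]} := by simp [Gam]

theorem Gam_add_one (ξ : Ordinal) : Gam (ξ + 1) = ⋃ n : ℕ, GamN ξ n := by
  simp only [Gam, GamN, Ordinal.limitRecOn_add_one]

theorem Gam_limit {ξ : Ordinal} (hξ : Order.IsSuccLimit ξ) :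
    Gam ξ = ⋃ ζ, ⋃ _ : ζ < ξ, shift (Ordinal.omega0 ^ ζ) (Gam (ζ + 1)) := by
  rw [Gam, Ordinal.limitRecOn_limit _ _ _ _ hξ]
  rfl

theorem maxMembers_subset (S : Set (List Λ)) : maxMembers S ⊆ S := fun _ h => h.1

theorem map_prefix_map_iff {Λ' : Type*} {f : Λ → Λ'} (hf : Function.Injective f) {s t : List Λ} :
    s.map f <+: t.map f ↔ s <+: t := by
  constructor
  · rintro ⟨u, hu⟩
    obtain ⟨l₁, l₂, rfl, h₁, -⟩ := List.map_eq_append_iff.1 hu.symm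
    rw [List.map_injective_iff.2 hf h₁]
    exact List.prefix_append _ _
  · exact fun h => h.map f

theorem ordinal_add_left_injective (ζ : Ordinal) : Function.Injective (fun η => ζ + η) :=
  fun _ _ h => by simpa using h

theorem map_mem_shift_iff {ζ : Ordinal} {S : Set (List Ordinal)} {t : List Ordinal} :
    t.map (fun η => ζ + η) ∈ shift ζ S ↔ t ∈ S :=
  (List.map_injective_iff.2 (ordinal_add_left_injective ζ)).mem_set_image

theorem maxMembers_shift (ζ : Ordinal) (S : Set (List Ordinal)) :
    maxMembers (shift ζ S) = shift ζ (maxMembers S) := by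
  ext t
  constructor
  · rintro ⟨⟨t, ht, rfl⟩, h⟩
    refine ⟨t, ⟨ht, fun s hs hts => ?_⟩, rfl⟩
    exact List.map_injective_iff.2 (ordinal_add_left_injective ζ)
      (h _ (map_mem_shift_iff.2 hs) (hts.map _))
  · rintro ⟨t, ⟨ht, h⟩, rfl⟩
    refine ⟨map_mem_shift_iff.2 ht, ?_⟩
    rintro _ ⟨s, hs, rfl⟩ hts
    exact congrArg _ (h s hs ((map_prefix_map_iff (ordinal_add_left_injective ζ)).1 hts))

theorem GamN_zero (ξ : Ordinal) : GamN ξ 0 = ∅ := rfl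

theorem mem_GamN_add_one {ξ : Ordinal} {n : ℕ} {v : List Ordinal} :
    v ∈ GamN ξ (n + 1) ↔
      (∃ t ∈ Gam ξ, v = t.map (fun η => Ordinal.omega0 ^ ξ * n + η)) ∨
      ∃ t ∈ maxMembers (Gam ξ), ∃ u ∈ GamN ξ n,
        v = t.map (fun η => Ordinal.omega0 ^ ξ * n + η) ++ u := by
  have : v ∈ GamN ξ (n + 1) ↔ v ∈ shift (Ordinal.omega0 ^ ξ * n) (Gam ξ) ∨
      ∃ t ∈ maxMembers (shift (Ordinal.omega0 ^ ξ * n) (Gam ξ)), ∃ u ∈ GamN ξ n, v = t ++ u :=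
    Iff.rfl
  rw [this, maxMembers_shift]
  simp only [shift, Set.mem_image, exists_exists_and_eq_and]
  simp only [eq_comm (b := v)]

theorem GamN_one (ξ : Ordinal) : GamN ξ 1 = Gam ξ := by
  ext v
  rw [← zero_add 1, mem_GamN_add_one]
  simp [GamN_zero]

theorem forall_lt_of_mem_GamN {ξ : Ordinal}
    (h : ∀ t ∈ Gam ξ, t ≠ [] ∧ ∀ η ∈ t, η < Ordinal.omega0 ^ ξ) (n : ℕ) :
    ∀ t ∈ GamN ξ n, t ≠ [] ∧ ∀ η ∈ t, η < Ordinal.omega0 ^ ξ * n := by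
  induction n with
  | zero => simp [GamN_zero]
  | succ n ih =>
    have key : ∀ t ∈ Gam ξ, ∀ η ∈ t.map (fun η => Ordinal.omega0 ^ ξ * n + η),
        η < Ordinal.omega0 ^ ξ * (n + 1 : ℕ) := by
      intro t ht η hη
      obtain ⟨η, hη', rfl⟩ := List.mem_map.1 hη
      rw [Nat.cast_add_one, mul_add_one]
      exact (add_lt_add_iff_left _).2 ((h t ht).2 η hη')
    intro t ht
    rcases mem_GamN_add_one.1 ht with ⟨t₀, ht₀, rfl⟩ | ⟨t₀, ht₀, u, hu, rfl⟩
    · exact ⟨by simpa using (h t₀ ht₀).1, key t₀ ht₀⟩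
    · refine ⟨by simp [(ih u hu).1], fun η hη => ?_⟩
      rcases List.mem_append.1 hη with hη | hη
      · exact key t₀ ht₀.1 η hη
      · refine ((ih u hu).2 η hη).trans_le ?_
        gcongr
        simp

theorem Gam_bound (ξ : Ordinal) : ∀ t ∈ Gam ξ, t ≠ [] ∧ ∀ η ∈ t, η < Ordinal.omega0 ^ ξ := by
  induction ξ using Ordinal.limitRecOn with
  | zero => simp [Gam_zero]
  | add_one ξ ih =>
    intro t ht
    rw [Gam_add_one] at ht
    obtain ⟨n, ht⟩ := Set.mem_iUnion.1 ht
    refine ⟨(forall_lt_of_mem_GamN ih n t ht).1, fun η hη => ?_⟩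
    refine ((forall_lt_of_mem_GamN ih n t ht).2 η hη).trans ?_
    exact Ordinal.opow_mul_lt_opow (Ordinal.natCast_lt_omega0 n) (lt_add_one ξ)
  | limit ξ hξ ih =>
    intro t ht
    simp only [Gam_limit hξ, Set.mem_iUnion] at ht
    obtain ⟨ζ, hζ, t, ht, rfl⟩ := ht
    have h := ih (ζ + 1) (hξ.add_one_lt hζ) t ht
    refine ⟨by simpa using h.1, fun η hη => ?_⟩
    obtain ⟨η, hη', rfl⟩ := List.mem_map.1 hη
    have h1 : Ordinal.omega0 ^ (ζ + 1) < Ordinal.omega0 ^ ξ :=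
      (Ordinal.opow_lt_opow_iff_right Ordinal.one_lt_omega0).2 (hξ.add_one_lt hζ)
    refine Ordinal.isPrincipal_add_omega0_opow ξ ?_ ((h.2 η hη').trans h1)
    exact (Ordinal.opow_lt_opow_iff_right Ordinal.one_lt_omega0).2 hζ

theorem ne_nil_of_mem_Gam {ξ : Ordinal} {t : List Ordinal} (h : t ∈ Gam ξ) : t ≠ [] :=
  (Gam_bound ξ t h).1

theorem lt_of_mem_Gam {ξ : Ordinal} {t : List Ordinal} (h : t ∈ Gam ξ) {η : Ordinal}
    (hη : η ∈ t) : η < Ordinal.omega0 ^ ξ :=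
  (Gam_bound ξ t h).2 η hη

theorem ne_nil_of_mem_GamN {ξ : Ordinal} {n : ℕ} {t : List Ordinal} (h : t ∈ GamN ξ n) : t ≠ [] :=
  (forall_lt_of_mem_GamN (Gam_bound ξ) n t h).1

theorem lt_of_mem_GamN {ξ : Ordinal} {n : ℕ} {t : List Ordinal} (h : t ∈ GamN ξ n) {η : Ordinal}
    (hη : η ∈ t) : η < Ordinal.omega0 ^ ξ * n :=
  (forall_lt_of_mem_GamN (Gam_bound ξ) n t h).2 η hη

theorem headD_map_of_ne_nil {Λ' : Type*} (f : Λ → Λ') {t : List Λ} (h : t ≠ []) (a : Λ) (b : Λ') :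
    (t.map f).headD b = f (t.headD a) := by
  cases t <;> simp_all

theorem headD_append_of_ne_nil {t : List Λ} (h : t ≠ []) (u : List Λ) (a : Λ) :
    (t ++ u).headD a = t.headD a := by
  cases t <;> simp_all

theorem headD_mem {t : List Λ} (h : t ≠ []) (a : Λ) : t.headD a ∈ t := by
  cases t <;> simp_all

theorem headD_eq_of_prefix {s t : List Λ} (hs : s ≠ []) (h : s <+: t) (a : Λ) :
    t.headD a = s.headD a := by
  obtain ⟨u, rfl⟩ := h
  exact headD_append_of_ne_nil hs u a

theorem getLastD_map_of_ne_nil {Λ' : Type*} (f : Λ → Λ') {t : List Λ} (h : t ≠ []) (a : Λ)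
    (b : Λ') : (t.map f).getLastD b = f (t.getLastD a) := by
  rw [List.getLastD_eq_getLast?, List.getLastD_eq_getLast?, List.getLast?_map,
    List.getLast?_eq_getLast_of_ne_nil h]
  rfl

theorem getLastD_append_of_ne_nil (t : List Λ) {u : List Λ} (h : u ≠ []) (a : Λ) :
    (t ++ u).getLastD a = u.getLastD a := by
  rw [List.getLastD_eq_getLast?, List.getLastD_eq_getLast?,
    List.getLast?_append_of_ne_nil _ h]

theorem getLastD_mem {t : List Λ} (h : t ≠ []) (a : Λ) : t.getLastD a ∈ t := by
  rw [List.getLastD_eq_getLast?, List.getLast?_eq_getLast_of_ne_nil h]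
  exact List.getLast_mem h

theorem mul_nat_add_div {ξ η : Ordinal} (n : ℕ) (hη : η < Ordinal.omega0 ^ ξ) :
    (Ordinal.omega0 ^ ξ * n + η) / Ordinal.omega0 ^ ξ = n := by
  rw [Ordinal.mul_add_div _ (omega_opow_ne_zero ξ), Ordinal.div_eq_zero_of_lt hη, add_zero]

theorem mul_nat_add_mod {ξ η : Ordinal} (n : ℕ) (hη : η < Ordinal.omega0 ^ ξ) :
    (Ordinal.omega0 ^ ξ * n + η) % Ordinal.omega0 ^ ξ = η := by
  rw [Ordinal.mul_add_mod_self, Ordinal.mod_eq_of_lt hη]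

theorem div_lt_of_mem_GamN {ξ : Ordinal} {n : ℕ} {t : List Ordinal} (h : t ∈ GamN ξ n)
    {η : Ordinal} (hη : η ∈ t) : η / Ordinal.omega0 ^ ξ < n :=
  (Ordinal.lt_mul_iff_div_lt (omega_opow_ne_zero ξ)).1 (lt_of_mem_GamN h hη)

theorem headD_div_of_mem_GamN {ξ : Ordinal} {n : ℕ} {t : List Ordinal} (h : t ∈ GamN ξ n) :
    t.headD 0 / Ordinal.omega0 ^ ξ + 1 = n := by
  cases n with
  | zero => simp [GamN_zero] at h
  | succ n =>
    have key : ∀ t ∈ Gam ξ, (t.map (fun η => Ordinal.omega0 ^ ξ * n + η)).headD 0 /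
        Ordinal.omega0 ^ ξ = n := fun t ht => by
      rw [headD_map_of_ne_nil _ (ne_nil_of_mem_Gam ht) 0]
      exact mul_nat_add_div n (lt_of_mem_Gam ht (headD_mem (ne_nil_of_mem_Gam ht) 0))
    rcases mem_GamN_add_one.1 h with ⟨t₀, ht₀, rfl⟩ | ⟨t₀, ht₀, u, hu, rfl⟩
    · rw [key t₀ ht₀, Nat.cast_add_one]
    · rw [headD_append_of_ne_nil (by simpa using ne_nil_of_mem_Gam ht₀.1), key t₀ ht₀.1,
        Nat.cast_add_one]

/-- The first entry has quotient `n - 1` by `ω ^ ξ`, so it determines `n`. Hence the pieces `Γ_{ξ,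
n}` of `Γ_{ξ+1}` are mutually incomparable, and maximality can be tested within one piece. -/
theorem eq_of_mem_GamN_of_prefix {ξ : Ordinal} {m n : ℕ} {s t : List Ordinal}
    (hs : s ∈ GamN ξ m) (ht : t ∈ GamN ξ n) (h : s <+: t) : m = n := by
  have h1 := headD_div_of_mem_GamN hs
  rw [← headD_eq_of_prefix (ne_nil_of_mem_GamN hs) h, headD_div_of_mem_GamN ht] at h1
  exact_mod_cast h1.symm

theorem prefix_mem_GamN {ξ : Ordinal} (h : ∀ t ∈ Gam ξ, ∀ s, s ≠ [] → s <+: t → s ∈ Gam ξ) (n : ℕ) :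
    ∀ t ∈ GamN ξ n, ∀ s, s ≠ [] → s <+: t → s ∈ GamN ξ n := by
  induction n with
  | zero => simp [GamN_zero]
  | succ n ih =>
    have key : ∀ t ∈ Gam ξ, ∀ s, s ≠ [] → s <+: t.map (fun η => Ordinal.omega0 ^ ξ * n + η) →
        s ∈ GamN ξ (n + 1) := by
      intro t ht s hs hst
      obtain ⟨l, hl, rfl⟩ := List.prefix_map_iff.1 hst
      exact mem_GamN_add_one.2 (Or.inl ⟨l, h t ht l (by simpa using hs) hl, rfl⟩)
    intro t ht s hs hst
    rcases mem_GamN_add_one.1 ht with ⟨t₀, ht₀, rfl⟩ | ⟨t₀, ht₀, u, hu, rfl⟩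
    · exact key t₀ ht₀ s hs hst
    · rcases List.prefix_or_prefix_of_prefix hst (List.prefix_append _ _) with h' | h'
      · exact key t₀ ht₀.1 s hs h'
      · obtain ⟨u', rfl⟩ := h'
        rcases eq_or_ne u' [] with rfl | hu'
        · exact key t₀ ht₀.1 _ hs (by simp)
        · exact mem_GamN_add_one.2 (Or.inr ⟨t₀, ht₀, u',
            ih u hu u' hu' ((List.prefix_append_right_inj _).1 hst), rfl⟩)

theorem prefix_mem_Gam (ξ : Ordinal) : ∀ t ∈ Gam ξ, ∀ s, s ≠ [] → s <+: t → s ∈ Gam ξ := by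
  induction ξ using Ordinal.limitRecOn with
  | zero =>
    rw [Gam_zero]
    rintro t rfl s hs hst
    rcases List.prefix_cons_iff.1 hst with h | ⟨t, rfl, ht⟩
    · exact absurd h hs
    · simpa using ht
  | add_one ξ ih =>
    intro t ht s hs hst
    rw [Gam_add_one] at ht ⊢
    obtain ⟨n, ht⟩ := Set.mem_iUnion.1 ht
    exact Set.mem_iUnion.2 ⟨n, prefix_mem_GamN ih n t ht s hs hst⟩
  | limit ξ hξ ih =>
    intro t ht s hs hst
    simp only [Gam_limit hξ, Set.mem_iUnion] at ht ⊢
    obtain ⟨ζ, hζ, t, ht, rfl⟩ := ht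
    obtain ⟨l, hl, rfl⟩ := List.prefix_map_iff.1 hst
    exact ⟨ζ, hζ, l, ih (ζ + 1) (hξ.add_one_lt hζ) t ht l (by simpa using hs) hl, rfl⟩

theorem append_mem_maxMembers_GamN {ξ : Ordinal} {n : ℕ} {t u : List Ordinal}
    (ht : t ∈ maxMembers (Gam ξ)) (hu : u ∈ maxMembers (GamN ξ n)) :
    t.map (fun η => Ordinal.omega0 ^ ξ * n + η) ++ u ∈ maxMembers (GamN ξ (n + 1)) := by
  refine ⟨mem_GamN_add_one.2 (Or.inr ⟨t, ht, u, hu.1, rfl⟩), fun v hv hpre => ?_⟩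
  rcases mem_GamN_add_one.1 hv with ⟨t', ht', rfl⟩ | ⟨t', ht', u', hu', rfl⟩
  -- An extension within the first unit has all entries at least `ω ^ ξ * n`, whereas those of `u`
  -- are smaller.
  · exfalso
    have hne := ne_nil_of_mem_GamN hu.1
    have h1 : u.headD 0 ∈ t'.map (fun η => Ordinal.omega0 ^ ξ * n + η) :=
      hpre.subset (List.mem_append_right _ (headD_mem hne 0))
    obtain ⟨η, -, hη⟩ := List.mem_map.1 h1
    have h2 := lt_of_mem_GamN hu.1 (headD_mem hne 0)
    rw [← hη] at h2
    exact absurd h2 (not_lt.2 le_self_add)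
  · have h1 := (List.prefix_append _ u).trans hpre
    have h2 : t' = t := by
      rcases List.prefix_or_prefix_of_prefix h1 (List.prefix_append _ u') with h | h
      · exact ht.2 t' ht'.1 ((map_prefix_map_iff (ordinal_add_left_injective _)).1 h)
      · exact (ht'.2 t ht.1 ((map_prefix_map_iff (ordinal_add_left_injective _)).1 h)).symm
    subst h2
    rw [hu.2 u' hu' ((List.prefix_append_right_inj _).1 hpre)]

theorem mem_maxMembers_Gam_add_one {ξ : Ordinal} {n : ℕ} {t : List Ordinal}
    (ht : t ∈ maxMembers (GamN ξ n)) : t ∈ maxMembers (Gam (ξ + 1)) := by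
  rw [Gam_add_one]
  refine ⟨Set.mem_iUnion.2 ⟨n, ht.1⟩, fun s hs hts => ?_⟩
  obtain ⟨m, hs⟩ := Set.mem_iUnion.1 hs
  obtain rfl := eq_of_mem_GamN_of_prefix ht.1 hs hts
  exact ht.2 s hs hts

/-- The first entry lies in `[ω ^ ζ, ω ^ (ζ+1))`. This recovers `ζ` at limit stages, both for
maximality and for the weights. -/
theorem log_headD_of_mem_Gam {ζ : Ordinal} {t : List Ordinal} (ht : t ∈ Gam (ζ + 1)) :
    Ordinal.log Ordinal.omega0 ((t.map (fun η => Ordinal.omega0 ^ ζ + η)).headD 0) = ζ := by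
  have hne := ne_nil_of_mem_Gam ht
  rw [headD_map_of_ne_nil _ hne 0]
  refine (Ordinal.log_eq_iff Ordinal.one_lt_omega0
    ((omega_opow_pos ζ).trans_le le_self_add).ne' _).2 ⟨le_self_add, ?_⟩
  refine Ordinal.isPrincipal_add_omega0_opow (ζ + 1) ?_ (lt_of_mem_Gam ht (headD_mem hne 0))
  exact (Ordinal.opow_lt_opow_iff_right Ordinal.one_lt_omega0).2 (lt_add_one ζ)

theorem shift_mem_maxMembers_Gam {ξ ζ : Ordinal} (hξ : Order.IsSuccLimit ξ) (hζ : ζ < ξ)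
    {t : List Ordinal} (ht : t ∈ maxMembers (Gam (ζ + 1))) :
    t.map (fun η => Ordinal.omega0 ^ ζ + η) ∈ maxMembers (Gam ξ) := by
  rw [Gam_limit hξ]
  refine ⟨Set.mem_iUnion₂.2 ⟨ζ, hζ, map_mem_shift_iff.2 ht.1⟩, fun s hs hts => ?_⟩
  obtain ⟨ζ', hζ', s, hs', rfl⟩ := Set.mem_iUnion₂.1 hs
  have h1 := log_headD_of_mem_Gam hs'
  simp only at hts ⊢
  rw [headD_eq_of_prefix (by simpa using ne_nil_of_mem_Gam ht.1) hts,
    log_headD_of_mem_Gam ht.1] at h1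
  subst h1
  rw [ht.2 s hs' ((map_prefix_map_iff (ordinal_add_left_injective _)).1 hts)]

end Trees

/-! ### Recursion formulas for the weights `ℙ_ξ`. -/

section Weights

theorem weight_zero (t : List Ordinal) : weight 0 t = 1 := by simp [weight]

theorem weight_add_one {ξ : Ordinal} {n : ℕ} {t : List Ordinal} (ht : t ∈ GamN ξ n) :
    weight (ξ + 1) t = (1 / n : ℝ) * weight ξ (unitPart ξ t) := by
  have : {m : ℕ | t ∈ GamN ξ m} = {n} := by
    ext m
    exact ⟨fun h => eq_of_mem_GamN_of_prefix h ht List.prefix_rfl, fun h => h ▸ ht⟩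
  simp only [weight, Ordinal.limitRecOn_add_one]
  rw [this, csInf_singleton]

theorem weight_limit {ξ ζ : Ordinal} (hξ : Order.IsSuccLimit ξ) (hζ : ζ < ξ)
    {t : List Ordinal} (ht : t ∈ Gam (ζ + 1)) :
    weight ξ (t.map (fun η => Ordinal.omega0 ^ ζ + η)) = weight (ζ + 1) t := by
  rw [weight, Ordinal.limitRecOn_limit _ _ _ _ hξ]
  have h := log_headD_of_mem_Gam ht
  simp only
  rw [dif_pos (by rwa [h])]
  have : (t.map (fun η => Ordinal.omega0 ^ ζ + η)).map (fun η => η - Ordinal.omega0 ^ ζ) = t := by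
    simp [Function.comp_def]
  simp only [h, this]
  rfl

theorem unitPart_shift {ξ : Ordinal} (n : ℕ) {t : List Ordinal}
    (h : ∀ η ∈ t, η < Ordinal.omega0 ^ ξ) :
    unitPart ξ (t.map (fun η => Ordinal.omega0 ^ ξ * n + η)) = t := by
  rcases eq_or_ne t [] with rfl | hne
  · simp [unitPart]
  rw [unitPart, getLastD_map_of_ne_nil _ hne 0, mul_nat_add_div n (h _ (getLastD_mem hne 0)),
    List.filter_eq_self.2, List.map_map]
  · conv_rhs => rw [← List.map_id t]
    exact List.map_congr_left fun η hη => mul_nat_add_mod n (h η hη)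
  · intro η hη
    obtain ⟨η, hη', rfl⟩ := List.mem_map.1 hη
    simpa using mul_nat_add_div n (h η hη')

theorem unitPart_append {ξ : Ordinal} (n : ℕ) {t u : List Ordinal}
    (h : ∀ η ∈ t, η < Ordinal.omega0 ^ ξ) (hu : u ≠ [])
    (h' : ∀ η ∈ u, η < Ordinal.omega0 ^ ξ * n) :
    unitPart ξ (t.map (fun η => Ordinal.omega0 ^ ξ * n + η) ++ u) = unitPart ξ u := by
  have h1 := (Ordinal.lt_mul_iff_div_lt (omega_opow_ne_zero ξ)).1 (h' _ (getLastD_mem hu 0))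
  rw [unitPart, unitPart, getLastD_append_of_ne_nil _ hu, List.filter_append,
    List.filter_eq_nil_iff.2, List.nil_append]
  intro η hη
  obtain ⟨η, hη', rfl⟩ := List.mem_map.1 hη
  simp only [mul_nat_add_div n (h η hη'), decide_eq_true_eq]
  exact fun h => h1.ne h.symm

end Weights

noncomputable section

/-! ### Recursion formulas for the convex blocks. -/

section Blocks

variable (𝕜 : Type*) [RCLike 𝕜] {X : Type*} [NormedAddCommGroup X] [NormedSpace 𝕜 X] {D : Type*}

/-- The sum of `ℙ_ξ(s) x_s` over all nonempty initial segments `s` of `t`. -/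
def unitSum (ξ : Ordinal) (x : List (Ordinal × D) → X) (t : List (Ordinal × D)) : X :=
  ∑ k ∈ Finset.range t.length,
    (weight ξ ((t.take (k + 1)).map Prod.fst) : 𝕜) • x (t.take (k + 1))

/-- `ζ + t`, the addition being applied to the ordinal coordinates. -/
def shiftPairs (ζ : Ordinal) (t : List (Ordinal × D)) : List (Ordinal × D) :=
  t.map (fun p => (ζ + p.1, p.2))

theorem map_fst_shiftPairs (ζ : Ordinal) (t : List (Ordinal × D)) :
    (shiftPairs ζ t).map Prod.fst = (t.map Prod.fst).map (fun η => ζ + η) := by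
  simp [shiftPairs, Function.comp_def]

theorem length_shiftPairs (ζ : Ordinal) (t : List (Ordinal × D)) :
    (shiftPairs ζ t).length = t.length := List.length_map _

theorem take_shiftPairs (ζ : Ordinal) (t : List (Ordinal × D)) (k : ℕ) :
    (shiftPairs ζ t).take k = shiftPairs ζ (t.take k) := List.map_take.symm

theorem take_add_one_ne_nil {Λ : Type*} {t : List Λ} {k : ℕ} (hk : k < t.length) :
    t.take (k + 1) ≠ [] := by
  cases t <;> simp_all

theorem map_fst_take_mem_Gam {ξ : Ordinal} {t : List (Ordinal × D)} (ht : t.map Prod.fst ∈ Gam ξ)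
    {k : ℕ} (hk : k < t.length) : (t.take (k + 1)).map Prod.fst ∈ Gam ξ :=
  prefix_mem_Gam ξ _ ht _ (by simpa using take_add_one_ne_nil hk) ((List.take_prefix _ _).map _)

theorem map_fst_take_mem_GamN {ξ : Ordinal} {n : ℕ} {t : List (Ordinal × D)}
    (ht : t.map Prod.fst ∈ GamN ξ n) {k : ℕ} (hk : k < t.length) :
    (t.take (k + 1)).map Prod.fst ∈ GamN ξ n :=
  prefix_mem_GamN (prefix_mem_Gam ξ) n _ ht _ (by simpa using take_add_one_ne_nil hk)
    ((List.take_prefix _ _).map _)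

theorem unitSum_zero (x : List (Ordinal × D) → X) (p : Ordinal × D) :
    unitSum 𝕜 0 x [p] = x [p] := by
  simp [unitSum, weight_zero]

theorem unitSum_limit {ξ ζ : Ordinal} (hξ : Order.IsSuccLimit ξ) (hζ : ζ < ξ)
    (x : List (Ordinal × D) → X) {t : List (Ordinal × D)} (ht : t.map Prod.fst ∈ Gam (ζ + 1)) :
    unitSum 𝕜 ξ x (shiftPairs (Ordinal.omega0 ^ ζ) t) =
      unitSum 𝕜 (ζ + 1) (fun s => x (shiftPairs (Ordinal.omega0 ^ ζ) s)) t := by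
  rw [unitSum, length_shiftPairs]
  refine Finset.sum_congr rfl fun k hk => ?_
  rw [take_shiftPairs, map_fst_shiftPairs,
    weight_limit hξ hζ (map_fst_take_mem_Gam ht (Finset.mem_range.1 hk))]

theorem convexBlock_eq_sum (ξ : Ordinal) (n : ℕ) (x : List (Ordinal × D) → X)
    (t : List (Ordinal × D)) (i : ℕ) (P : ℕ → Prop) [DecidablePred P]
    (hP : ∀ k < t.length, (t.take (k + 1)).map Prod.fst ∈ level ξ n i ↔ P k) :
    convexBlock 𝕜 ξ n x t i = ∑ k ∈ Finset.range t.length, if P k then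
      (weight ξ (unitPart ξ ((t.take (k + 1)).map Prod.fst)) : 𝕜) • x (t.take (k + 1)) else 0 := by
  refine Finset.sum_congr rfl fun k hk => ?_
  simp only [hP k (Finset.mem_range.1 hk)]

/-- Every nonempty initial segment of `t` lies on exactly one level, so after interchanging the sums
one term survives for each segment. -/
theorem unitSum_add_one {ξ : Ordinal} {n : ℕ} (x : List (Ordinal × D) → X)
    {t : List (Ordinal × D)} (ht : t.map Prod.fst ∈ GamN ξ n) :
    unitSum 𝕜 (ξ + 1) x t =
      ((1 / n : ℝ) : 𝕜) • ∑ i ∈ Finset.range n, convexBlock 𝕜 ξ n x t (i + 1) := by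
  classical
  simp only [convexBlock]
  rw [Finset.sum_comm, Finset.smul_sum]
  refine Finset.sum_congr rfl fun k hk => ?_
  have hs := map_fst_take_mem_GamN ht (Finset.mem_range.1 hk)
  set s := (t.take (k + 1)).map Prod.fst with hs_def
  have hlt := div_lt_of_mem_GamN hs (getLastD_mem (ne_nil_of_mem_GamN hs) 0)
  obtain ⟨m, hm⟩ := Ordinal.lt_omega0.1 (hlt.trans (Ordinal.natCast_lt_omega0 n))
  have hmn : m < n := by rw [hm] at hlt; exact_mod_cast hlt
  -- A last entry with quotient `m` is on level `n - m`, which has index `n - 1 - m` when counted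
  -- from zero.
  have hlev : ∀ i ∈ Finset.range n, s ∈ level ξ n (i + 1) ↔ i = n - 1 - m := by
    intro i hi
    rw [Finset.mem_range] at hi
    simp only [level, Set.mem_ofPred_eq, hs, true_and, hm]
    norm_cast
    omega
  rw [Finset.sum_congr rfl (g := fun i => if i = n - 1 - m then
      (weight ξ (unitPart ξ s) : 𝕜) • x (t.take (k + 1)) else 0)
      (fun i hi => by simp only [hlev i hi]),
    Finset.sum_ite_eq', if_pos (Finset.mem_range.2 (by omega)), weight_add_one hs, smul_smul]
  push_cast
  rfl

theorem convexBlock_one {ξ : Ordinal} (x : List (Ordinal × D) → X)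
    {t : List (Ordinal × D)} (ht : t.map Prod.fst ∈ Gam ξ) :
    convexBlock 𝕜 ξ 1 x t 1 = unitSum 𝕜 ξ x t := by
  rw [convexBlock_eq_sum 𝕜 ξ 1 x t 1 (fun _ => True), unitSum]
  · refine Finset.sum_congr rfl fun k hk => ?_
    have hs := map_fst_take_mem_Gam ht (Finset.mem_range.1 hk)
    have := unitPart_shift 0 (fun η hη => lt_of_mem_Gam hs hη)
    simp only [Nat.cast_zero, mul_zero, zero_add, List.map_id'] at this
    rw [if_pos trivial, this]
  · intro k hk
    have hs := map_fst_take_mem_Gam ht hk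
    simp only [level, GamN_one, Set.mem_ofPred_eq, hs,
      Ordinal.div_eq_zero_of_lt (lt_of_mem_Gam hs (getLastD_mem (ne_nil_of_mem_Gam hs) 0))]
    simp

variable {ξ : Ordinal} {n : ℕ} {t u : List (Ordinal × D)}

theorem map_fst_append_mem_GamN (ht : t.map Prod.fst ∈ maxMembers (Gam ξ))
    (hu : u.map Prod.fst ∈ GamN ξ n) :
    (shiftPairs (Ordinal.omega0 ^ ξ * n) t ++ u).map Prod.fst ∈ GamN ξ (n + 1) := by
  rw [List.map_append, map_fst_shiftPairs]
  exact mem_GamN_add_one.2 (Or.inr ⟨_, ht, _, hu, rfl⟩)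

theorem map_fst_shiftPairs_mem_GamN (n : ℕ) (ht : t.map Prod.fst ∈ Gam ξ) :
    (shiftPairs (Ordinal.omega0 ^ ξ * n) t).map Prod.fst ∈ GamN ξ (n + 1) := by
  rw [map_fst_shiftPairs]
  exact mem_GamN_add_one.2 (Or.inl ⟨_, ht, rfl⟩)

theorem map_fst_shiftPairs_mem_level (i : ℕ) (ht : t.map Prod.fst ∈ Gam ξ) :
    (shiftPairs (Ordinal.omega0 ^ ξ * n) t).map Prod.fst ∈ level ξ (n + 1) (i + 1) ↔ i = 0 := by
  have hne := ne_nil_of_mem_Gam ht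
  have h := map_fst_shiftPairs_mem_GamN n ht
  simp only [level, Set.mem_ofPred_eq, h, true_and]
  rw [map_fst_shiftPairs, getLastD_map_of_ne_nil _ hne 0,
    mul_nat_add_div n (lt_of_mem_Gam ht (getLastD_mem hne 0))]
  norm_cast
  omega

theorem map_fst_append_mem_level (i : ℕ) (ht : t.map Prod.fst ∈ maxMembers (Gam ξ))
    (hu : u.map Prod.fst ∈ GamN ξ n) :
    (shiftPairs (Ordinal.omega0 ^ ξ * n) t ++ u).map Prod.fst ∈ level ξ (n + 1) (i + 1) ↔
      u.map Prod.fst ∈ level ξ n i := by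
  have hne := ne_nil_of_mem_GamN hu
  have h := map_fst_append_mem_GamN ht hu
  simp only [level, Set.mem_ofPred_eq, h, hu, true_and]
  rw [List.map_append, getLastD_append_of_ne_nil _ hne]
  obtain ⟨m, hm⟩ := Ordinal.lt_omega0.1 ((div_lt_of_mem_GamN hu (getLastD_mem hne 0)).trans
    (Ordinal.natCast_lt_omega0 n))
  rw [hm]
  norm_cast
  omega

theorem not_mem_level_zero {s : List Ordinal} : s ∉ level ξ n 0 := by
  rintro ⟨hs, h⟩
  have := div_lt_of_mem_GamN hs (getLastD_mem (ne_nil_of_mem_GamN hs) 0)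
  rw [Nat.cast_zero, add_zero] at h
  exact this.ne h

/-- Prepending a unit moves each level of `u` down by one and makes the new unit level 1. For `i =
0` the last summand vanishes, as level 0 is empty. -/
theorem convexBlock_append (x : List (Ordinal × D) → X) (i : ℕ)
    (ht : t.map Prod.fst ∈ maxMembers (Gam ξ)) (hu : u.map Prod.fst ∈ GamN ξ n) :
    convexBlock 𝕜 ξ (n + 1) x (shiftPairs (Ordinal.omega0 ^ ξ * n) t ++ u) (i + 1) =
      (if i = 0 then unitSum 𝕜 ξ (fun s => x (shiftPairs (Ordinal.omega0 ^ ξ * n) s)) t else 0) +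
        convexBlock 𝕜 ξ n (fun s => x (shiftPairs (Ordinal.omega0 ^ ξ * n) t ++ s)) u i := by
  classical
  have htm := maxMembers_subset _ ht
  rw [convexBlock, List.length_append, Finset.sum_range_add, length_shiftPairs]
  congr 1
  · have key : ∀ k < t.length, (shiftPairs (Ordinal.omega0 ^ ξ * n) t ++ u).take (k + 1) =
        shiftPairs (Ordinal.omega0 ^ ξ * n) (t.take (k + 1)) := fun k hk => by
      rw [List.take_append_of_le_length (by rw [length_shiftPairs]; omega), take_shiftPairs]
    split_ifs with hi
    · refine Finset.sum_congr rfl fun k hk => ?_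
      rw [Finset.mem_range] at hk
      have hs := map_fst_take_mem_Gam htm hk
      rw [key k hk, if_pos ((map_fst_shiftPairs_mem_level i hs).2 hi), map_fst_shiftPairs,
        unitPart_shift n fun η hη => lt_of_mem_Gam hs hη]
    · refine Finset.sum_eq_zero fun k hk => ?_
      rw [Finset.mem_range] at hk
      rw [key k hk, if_neg fun h => hi ((map_fst_shiftPairs_mem_level i
        (map_fst_take_mem_Gam htm hk)).1 h)]
  · refine Finset.sum_congr rfl fun k hk => ?_
    rw [Finset.mem_range] at hk
    have hs := map_fst_take_mem_GamN hu hk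
    have key : (shiftPairs (Ordinal.omega0 ^ ξ * n) t ++ u).take (t.length + k + 1) =
        shiftPairs (Ordinal.omega0 ^ ξ * n) t ++ u.take (k + 1) := by
      rw [add_assoc, ← length_shiftPairs (Ordinal.omega0 ^ ξ * n) t, List.take_length_add_append]
    rw [key]
    refine if_congr (map_fst_append_mem_level i ht hs) ?_ rfl
    rw [List.map_append, map_fst_shiftPairs, unitPart_append n (fun η hη => lt_of_mem_Gam htm hη)
      (ne_nil_of_mem_GamN hs) (fun η hη => lt_of_mem_GamN hs hη)]

theorem convexBlock_zero (x : List (Ordinal × D) → X) : convexBlock 𝕜 ξ n x t 0 = 0 :=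
  Finset.sum_eq_zero fun _ _ => if_neg not_mem_level_zero

end Blocks

end

/-! ### Transfinite iteration of derivations. -/

section Iterates

variable {E : Type*} {d d' : Set E → Set E} {K L : Set E}

theorem derivIter_zero (d : Set E → Set E) (K : Set E) : derivIter d K (0 : Ordinal.{w}) = K := by
  simp [derivIter]

theorem derivIter_add_one (d : Set E → Set E) (K : Set E) (β : Ordinal.{w}) :
    derivIter d K (β + 1) = d (derivIter d K β) := by
  simp [derivIter, Ordinal.limitRecOn_add_one]

theorem derivIter_limit (d : Set E → Set E) (K : Set E) {β : Ordinal.{w}}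
    (hβ : Order.IsSuccLimit β) : derivIter d K β = ⋂ ζ, ⋂ _ : ζ < β, derivIter d K ζ := by
  rw [derivIter, Ordinal.limitRecOn_limit _ _ _ _ hβ]
  rfl

theorem derivIter_antitone (hd : ∀ K, d K ⊆ K) (K : Set E) :
    Antitone (derivIter d K : Ordinal.{w} → Set E) := by
  intro α β h
  induction β using Ordinal.limitRecOn with
  | zero => rw [nonpos_iff_eq_zero.1 h]
  | add_one β ih =>
    rcases h.lt_or_eq with h | rfl
    · rw [derivIter_add_one]
      exact (hd _).trans (ih (Order.lt_add_one_iff.1 h))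
    · exact subset_rfl
  | limit β hβ _ =>
    rcases h.lt_or_eq with h | rfl
    · rw [derivIter_limit d K hβ]
      exact Set.iInter₂_subset α h
    · exact subset_rfl

theorem derivIter_subset (hd : ∀ K, d K ⊆ K) (K : Set E) (β : Ordinal.{w}) :
    derivIter d K β ⊆ K :=
  (derivIter_antitone hd K (zero_le (a := β))).trans (derivIter_zero d K).subset

theorem derivIter_mono (hd : ∀ ⦃K L⦄, K ⊆ L → d K ⊆ d' L) (h : K ⊆ L) (β : Ordinal.{w}) :
    derivIter d K β ⊆ derivIter d' L β := by
  induction β using Ordinal.limitRecOn with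
  | zero => simpa only [derivIter_zero]
  | add_one β ih => simpa only [derivIter_add_one] using hd ih
  | limit β hβ ih =>
    rw [derivIter_limit d K hβ, derivIter_limit d' L hβ]
    exact Set.iInter₂_mono ih

theorem derivIter_add (hd : ∀ K, d K ⊆ K) (K : Set E) (α β : Ordinal.{w}) :
    derivIter d K (α + β) = derivIter d (derivIter d K α) β := by
  induction β using Ordinal.limitRecOn with
  | zero => rw [add_zero, derivIter_zero]
  | add_one β ih => rw [← add_assoc, derivIter_add_one, derivIter_add_one, ih]
  | limit β hβ ih =>
    rw [derivIter_limit d _ hβ, derivIter_limit d K (Ordinal.isSuccLimit_add α hβ)]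
    refine Set.Subset.antisymm (Set.subset_iInter₂ fun ζ hζ => ?_)
      (Set.subset_iInter₂ fun ζ hζ => ?_)
    · rw [← ih ζ hζ]
      have h : α + ζ < α + β := (add_lt_add_iff_left α).2 hζ
      exact Set.iInter₂_subset (α + ζ) h
    · obtain ⟨γ, hγ, h⟩ := (Ordinal.lt_add_iff hβ.ne_bot).1 hζ
      refine (Set.iInter₂_subset γ hγ).trans ?_
      rw [← ih γ hγ]
      exact derivIter_antitone hd K h

theorem derivIter_natCast (d : Set E → Set E) (K : Set E) (n : ℕ) :
    derivIter d K (n : Ordinal.{w}) = d^[n] K := by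
  induction n with
  | zero => simp [derivIter_zero]
  | succ n ih => rw [Nat.cast_add_one, derivIter_add_one, ih, Function.iterate_succ_apply']

theorem derivIter_mul_natCast (hd : ∀ K, d K ⊆ K) (K : Set E) (α : Ordinal.{w}) (n : ℕ) :
    derivIter d K (α * n) = (fun L => derivIter d L α)^[n] K := by
  induction n with
  | zero => simp [derivIter_zero]
  | succ n ih =>
    rw [Nat.cast_add_one, mul_add_one, derivIter_add hd, ih, Function.iterate_succ_apply']

end Iterates

/-! ### Szlenk derivations: weak* compactness, monotonicity and mixed iterates. -/

section Derivations

variable {𝕜 : Type*} [RCLike 𝕜] {X : Type*} [NormedAddCommGroup X] [NormedSpace 𝕜 X]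

/-- Compactness for the weak* topology. -/
def IsWeakStarCompact (K : Set (StrongDual 𝕜 X)) : Prop :=
  IsCompact (WeakDual.toStrongDual ⁻¹' K)

variable {K L : Set (StrongDual 𝕜 X)}

theorem IsWeakStarCompact.isClosed (hK : IsWeakStarCompact K) :
    IsClosed (WeakDual.toStrongDual ⁻¹' K) := IsCompact.isClosed hK

theorem IsWeakStarCompact.exists_tendsto (hK : IsWeakStarCompact K) {ι : Type*} (𝒰 : Ultrafilter ι)
    {f : ι → StrongDual 𝕜 X} (hf : ∀ᶠ i in 𝒰, f i ∈ K) :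
    ∃ y ∈ K, Filter.Tendsto (fun i => StrongDual.toWeakDual (f i)) 𝒰
      (𝓝 (StrongDual.toWeakDual y)) := by
  obtain ⟨y, hy, h⟩ := IsCompact.ultrafilter_le_nhds hK
    (𝒰.map fun i => StrongDual.toWeakDual (f i)) (Filter.le_principal_iff.2 hf)
  exact ⟨WeakDual.toStrongDual y, hy, h⟩

theorem IsWeakStarCompact.mem_of_tendsto (hK : IsWeakStarCompact K) {ι : Type*} {l : Filter ι}
    [l.NeBot] {f : ι → StrongDual 𝕜 X} (hf : ∀ᶠ i in l, f i ∈ K) {y : StrongDual 𝕜 X}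
    (h : Filter.Tendsto (fun i => StrongDual.toWeakDual (f i)) l
      (𝓝 (StrongDual.toWeakDual y))) : y ∈ K :=
  hK.isClosed.mem_of_tendsto h hf

theorem tendsto_eval {ι : Type*} {l : Filter ι} {f : ι → StrongDual 𝕜 X} {y : StrongDual 𝕜 X}
    (h : Filter.Tendsto (fun i => StrongDual.toWeakDual (f i)) l
      (𝓝 (StrongDual.toWeakDual y))) (v : X) :
    Filter.Tendsto (fun i => RCLike.re (f i v)) l (𝓝 (RCLike.re (y v))) :=
  (RCLike.continuous_re.tendsto _).comp (((WeakDual.eval_continuous v).tendsto _).comp h)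

theorem szlenkDeriv_subset (ε : ℝ) (K : Set (StrongDual 𝕜 X)) : szlenkDeriv ε K ⊆ K :=
  fun _ h => h.1

theorem szlenkDeriv_mono {ε δ : ℝ} (h : δ ≤ ε) (hKL : K ⊆ L) :
    szlenkDeriv ε K ⊆ szlenkDeriv δ L :=
  fun _ hf => ⟨hKL hf.1, fun hδ V hV => (ENNReal.ofReal_le_ofReal h).trans_lt
    ((hf.2 (hδ.trans_le h) V hV).trans_le (Metric.ediam_mono (Set.inter_subset_inter_right _ hKL)))⟩

theorem szlenkDeriv_zero (K : Set (StrongDual 𝕜 X)) : szlenkDeriv 0 K = K :=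
  Set.Subset.antisymm (szlenkDeriv_subset 0 K) fun _ h => ⟨h, fun h' => absurd h' (lt_irrefl 0)⟩

theorem IsWeakStarCompact.szlenkDeriv (hK : IsWeakStarCompact K) (ε : ℝ) :
    IsWeakStarCompact (szlenkDeriv ε K) := by
  have : WeakDual.toStrongDual ⁻¹' (XiSzlenk.szlenkDeriv ε K) = WeakDual.toStrongDual ⁻¹' K ∩
      {f | 0 < ε → ∀ V ∈ 𝓝 f,
        ENNReal.ofReal ε < Metric.ediam (StrongDual.toWeakDual ⁻¹' V ∩ K)} := rfl
  rw [IsWeakStarCompact, this]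
  refine IsCompact.inter_right hK ?_
  rw [← isOpen_compl_iff, isOpen_iff_mem_nhds]
  intro f hf
  simp only [Set.mem_compl_iff, Set.mem_ofPred_eq] at hf
  push Not at hf
  obtain ⟨hε, V, hV, h⟩ := hf
  -- A neighborhood `V` of small diameter in `K` is a neighborhood of all points near `f`, so the
  -- points removed form a relatively open set.
  filter_upwards [eventually_mem_nhds_iff.2 hV] with g hg
  simp only [Set.mem_compl_iff, Set.mem_ofPred_eq]
  push Not
  exact ⟨hε, V, hg, h⟩

theorem IsWeakStarCompact.derivIter {d : Set (StrongDual 𝕜 X) → Set (StrongDual 𝕜 X)}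
    (hd : ∀ K, IsWeakStarCompact K → IsWeakStarCompact (d K)) (hK : IsWeakStarCompact K)
    (β : Ordinal.{w}) : IsWeakStarCompact (derivIter d K β) := by
  induction β using Ordinal.limitRecOn with
  | zero => rwa [derivIter_zero]
  | add_one β ih => rw [derivIter_add_one]; exact hd _ ih
  | limit β hβ ih =>
    rw [derivIter_limit d K hβ, IsWeakStarCompact]
    simp only [Set.preimage_iInter]
    have h0 : (0 : Ordinal) < β := hβ.bot_lt
    exact IsCompact.of_isClosed_subset (ih 0 h0)
      (isClosed_biInter fun ζ hζ => (ih ζ hζ).isClosed) (Set.iInter₂_subset 0 h0)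

theorem szlenkDerivXi_subset (ξ : Ordinal.{w}) (ε : ℝ) (K : Set (StrongDual 𝕜 X)) :
    szlenkDerivXi ξ ε K ⊆ K := derivIter_subset (szlenkDeriv_subset ε) K _

theorem szlenkDerivXi_mono (ξ : Ordinal.{w}) {ε δ : ℝ} (h : δ ≤ ε) (hKL : K ⊆ L) :
    szlenkDerivXi ξ ε K ⊆ szlenkDerivXi ξ δ L :=
  derivIter_mono (fun _ _ => szlenkDeriv_mono h) hKL _

theorem szlenkDerivXi_anti {ξ ζ : Ordinal.{w}} (h : ζ ≤ ξ) (ε : ℝ) (K : Set (StrongDual 𝕜 X)) :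
    szlenkDerivXi ξ ε K ⊆ szlenkDerivXi ζ ε K :=
  derivIter_antitone (szlenkDeriv_subset ε) K (Ordinal.opow_le_opow_right Ordinal.omega0_pos h)

theorem IsWeakStarCompact.szlenkDerivXi (hK : IsWeakStarCompact K) (ξ : Ordinal.{w}) (ε : ℝ) :
    IsWeakStarCompact (szlenkDerivXi ξ ε K) :=
  hK.derivIter (fun _ h => h.szlenkDeriv ε) _

theorem szlenkDerivXi_ord_zero (ε : ℝ) (K : Set (StrongDual 𝕜 X)) :
    szlenkDerivXi (0 : Ordinal.{w}) ε K = szlenkDeriv ε K := by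
  rw [szlenkDerivXi, Ordinal.opow_zero, ← zero_add 1, derivIter_add_one, derivIter_zero]

/-- The multiples `ω ^ ξ * n` are cofinal in `ω ^ (ξ + 1)`. -/
theorem mem_szlenkDerivXi_add_one {ξ : Ordinal.{w}} {ε : ℝ} {f : StrongDual 𝕜 X}
    (h : ∀ n : ℕ, f ∈ (szlenkDerivXi ξ ε)^[n] K) : f ∈ szlenkDerivXi (ξ + 1) ε K := by
  rw [szlenkDerivXi, derivIter_limit _ _
    (Ordinal.isSuccLimit_opow_left Ordinal.isSuccLimit_omega0
      (add_pos_of_nonneg_of_pos zero_le one_pos).ne')]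
  refine Set.mem_iInter₂.2 fun γ hγ => ?_
  rw [← Order.succ_eq_add_one] at hγ
  obtain ⟨n, hn⟩ := Ordinal.lt_omega0_opow_succ.1 hγ
  refine derivIter_antitone (szlenkDeriv_subset ε) K hn.le ?_
  rw [derivIter_mul_natCast (szlenkDeriv_subset ε)]
  exact h n

theorem mem_szlenkDerivXi_limit {ξ : Ordinal.{w}} (hξ : Order.IsSuccLimit ξ) {ε : ℝ}
    {f : StrongDual 𝕜 X} (h : ∀ ζ < ξ, f ∈ szlenkDerivXi ζ ε K) : f ∈ szlenkDerivXi ξ ε K := by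
  rw [szlenkDerivXi, derivIter_limit _ _ (Ordinal.isSuccLimit_opow Ordinal.one_lt_omega0 hξ)]
  refine Set.mem_iInter₂.2 fun γ hγ => ?_
  obtain ⟨ζ, hζ, h'⟩ := (Ordinal.lt_opow_of_isSuccLimit Ordinal.omega0_ne_zero hξ).1 hγ
  exact derivIter_antitone (szlenkDeriv_subset ε) K h'.le (h ζ hζ)

/-- `s_{ξ, b 0} (s_{ξ, b 1} (⋯ K))`, with `n` derivations. -/
def mixedDeriv (ξ : Ordinal.{w}) (K : Set (StrongDual 𝕜 X)) : ℕ → (ℕ → ℝ) → Set (StrongDual 𝕜 X)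
  | 0, _ => K
  | n + 1, b => szlenkDerivXi ξ (b 0) (mixedDeriv ξ K n fun i => b (i + 1))

theorem mixedDeriv_subset (ξ : Ordinal.{w}) (K : Set (StrongDual 𝕜 X)) (n : ℕ) :
    ∀ b : ℕ → ℝ, mixedDeriv ξ K n b ⊆ K := by
  induction n with
  | zero => exact fun _ => subset_rfl
  | succ n ih => exact fun b => (szlenkDerivXi_subset ξ _ _).trans (ih _)

theorem IsWeakStarCompact.mixedDeriv (hK : IsWeakStarCompact K) (ξ : Ordinal.{w}) (n : ℕ) :
    ∀ b : ℕ → ℝ, IsWeakStarCompact (mixedDeriv ξ K n b) := by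
  induction n with
  | zero => exact fun _ => hK
  | succ n ih => exact fun b => (ih _).szlenkDerivXi ξ _

theorem mixedDeriv_anti (ξ : Ordinal.{w}) (K : Set (StrongDual 𝕜 X)) (n : ℕ) :
    ∀ b c : ℕ → ℝ, (∀ i < n, c i ≤ b i) → mixedDeriv ξ K n b ⊆ mixedDeriv ξ K n c := by
  induction n with
  | zero => exact fun _ _ _ => subset_rfl
  | succ n ih =>
    intro b c h
    exact szlenkDerivXi_mono ξ (h 0 (by omega)) (ih _ _ fun i hi => h (i + 1) (by omega))

/-- Derivations with parameter below `ε` are dropped, and the others have their parameter lowered to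
`ε`. Both changes enlarge the set. -/
theorem mixedDeriv_subset_iterate (ξ : Ordinal.{w}) (K : Set (StrongDual 𝕜 X)) (ε : ℝ) (n : ℕ) :
    ∀ b : ℕ → ℝ, mixedDeriv ξ K n b ⊆
      (szlenkDerivXi ξ ε)^[((Finset.range n).filter fun i => ε ≤ b i).card] K := by
  induction n with
  | zero => exact fun _ => subset_rfl
  | succ n ih =>
    intro b
    have : ((Finset.range (n + 1)).filter fun i => ε ≤ b i).card =
        ((Finset.range n).filter fun i => ε ≤ b (i + 1)).card + if ε ≤ b 0 then 1 else 0 := by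
      simp only [Finset.card_filter]
      exact Finset.sum_range_succ' _ n
    rw [this]
    split_ifs with h
    · rw [Function.iterate_succ_apply']
      exact szlenkDerivXi_mono ξ h (ih _)
    · exact (szlenkDerivXi_subset ξ _ _).trans (ih _)

theorem iterate_szlenkDerivXi_anti (ξ : Ordinal.{w}) (ε : ℝ) (K : Set (StrongDual 𝕜 X)) {m n : ℕ}
    (h : m ≤ n) : (szlenkDerivXi ξ ε)^[n] K ⊆ (szlenkDerivXi ξ ε)^[m] K := by
  rw [← derivIter_natCast.{w}, ← derivIter_natCast.{w}]
  exact derivIter_antitone (szlenkDerivXi_subset ξ ε) K (by exact_mod_cast h)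

theorem IsWeakStarCompact.iterate_szlenkDerivXi (hK : IsWeakStarCompact K) (ξ : Ordinal.{w})
    (ε : ℝ) (n : ℕ) : IsWeakStarCompact ((XiSzlenk.szlenkDerivXi ξ ε)^[n] K) := by
  rw [← derivIter_natCast.{w}]
  exact hK.derivIter (fun _ h => h.szlenkDerivXi ξ ε) _

/-- For a natural number `m` bounding the index, the `m`-th iterate is empty, so `m < n` is
impossible. -/
theorem natCast_le_toENN_szlenkXi {ξ : Ordinal.{w}} {ε : ℝ} {n : ℕ}
    (h : ((szlenkDerivXi ξ ε)^[n] K).Nonempty) : (n : ℝ≥0∞) ≤ toENN (szlenkXi ξ K ε) := by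
  refine le_iInf₂ fun m hm => ?_
  rw [szlenkXi] at hm
  split_ifs at hm with hex
  · have h0 := csInf_mem hex
    have h1 : derivIter (szlenkDerivXi ξ ε) K (m : Ordinal.{w}) = ∅ :=
      Set.subset_eq_empty (derivIter_antitone (szlenkDerivXi_subset ξ ε) K
        (WithTop.coe_le_coe.1 hm)) h0
    rw [derivIter_natCast] at h1
    rw [Nat.cast_le]
    by_contra! hmn
    exact (h.mono (iterate_szlenkDerivXi_anti ξ ε K hmn.le)).ne_empty h1
  · exact absurd hm (by simp)

theorem isWeakStarCompact_adjointBall {Y : Type*} [NormedAddCommGroup Y] [NormedSpace 𝕜 Y]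
    (A : X →L[𝕜] Y) : IsWeakStarCompact (adjointBall A) := by
  let T : WeakDual 𝕜 Y → WeakDual 𝕜 X :=
    fun g => StrongDual.toWeakDual ((WeakDual.toStrongDual g).comp A)
  have hT : Continuous T :=
    WeakDual.continuous_of_continuous_eval fun v => WeakDual.eval_continuous (A v)
  have h := (WeakDual.isCompact_closedBall (𝕜 := 𝕜) (0 : StrongDual 𝕜 Y) 1).image hT
  have heq : WeakDual.toStrongDual ⁻¹' adjointBall A =
      T '' (WeakDual.toStrongDual ⁻¹' Metric.closedBall (0 : StrongDual 𝕜 Y) 1) := ?_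
  · rwa [IsWeakStarCompact, heq]
  ext f
  constructor
  · rintro ⟨g, hg, hf⟩
    exact ⟨StrongDual.toWeakDual g, by simpa using hg, congrArg StrongDual.toWeakDual hf.symm⟩
  · rintro ⟨g, hg, rfl⟩
    exact ⟨WeakDual.toStrongDual g, by simpa using hg, rfl⟩

theorem norm_le_of_mem_adjointBall {Y : Type*} [NormedAddCommGroup Y] [NormedSpace 𝕜 Y]
    {A : X →L[𝕜] Y} (hA : ‖A‖ ≤ 1) {f : StrongDual 𝕜 X} (hf : f ∈ adjointBall A) : ‖f‖ ≤ 1 := by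
  obtain ⟨g, hg, rfl⟩ := hf
  exact (g.opNorm_comp_le A).trans (mul_le_one₀ hg (norm_nonneg A) hA)

end Derivations

/-! ### From weak `ℓ_p` to `ℓ_s`, and the exponents. -/

section Numerics

/-- The `k`-th largest value has at least `k` values not below it, with ties only raising this rank.
Inserting a minimal element gives it full rank and lowers no other rank. -/
theorem sum_rank_rpow_le {ι : Type*} (b : ι → ℝ) {s : ℝ} (hs : 0 ≤ s) (S : Finset ι) :
    ∑ i ∈ S, (((S.filter fun j => b i ≤ b j).card : ℝ) ^ s)⁻¹ ≤
      ∑ k ∈ Finset.range S.card, (((k + 1 : ℕ) : ℝ) ^ s)⁻¹ := by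
  classical
  induction S using Finset.induction_on_min_value b with
  | empty => simp
  | insert i S hi hmin ih =>
    rw [Finset.sum_insert hi, Finset.card_insert_of_notMem hi, Finset.sum_range_succ, add_comm]
    refine add_le_add ((Finset.sum_le_sum fun j hj => ?_).trans ih) ?_
    · have h1 : 0 < (S.filter fun k => b j ≤ b k).card :=
        Finset.card_pos.2 ⟨j, Finset.mem_filter.2 ⟨hj, le_rfl⟩⟩
      have h2 : (S.filter fun k => b j ≤ b k).card ≤
          ((insert i S).filter fun k => b j ≤ b k).card :=
        Finset.card_le_card (Finset.filter_subset_filter _ (Finset.subset_insert i S))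
      gcongr
    · rw [Finset.filter_true_of_mem, Finset.card_insert_of_notMem hi]
      intro j hj
      rcases Finset.mem_insert.1 hj with rfl | hj
      · exact le_rfl
      · exact hmin j hj

/-- Finite sequences whose distribution is of weak `ℓ_p` type are bounded in `ℓ_s`, for `s > p`. -/
theorem sum_rpow_le_of_card_le {p s : ℝ} (hp : 0 < p) (hps : p < s) {α : ℝ} (hα : 0 ≤ α)
    {ι : Type*} (S : Finset ι) (b : ι → ℝ) (hb : ∀ i ∈ S, 0 ≤ b i)
    (h : ∀ i ∈ S, 0 < b i → b i ^ p * (S.filter fun j => b i ≤ b j).card ≤ α) :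
    ∑ i ∈ S, b i ^ s ≤ α ^ (s / p) * ∑' k : ℕ, (((k + 1 : ℕ) : ℝ) ^ (s / p))⁻¹ := by
  have hs : 0 < s := hp.trans hps
  have hsum : Summable fun k : ℕ => (((k + 1 : ℕ) : ℝ) ^ (s / p))⁻¹ :=
    (summable_nat_add_iff 1 (f := fun k : ℕ => ((k : ℝ) ^ (s / p))⁻¹)).2
      (Real.summable_nat_rpow_inv.2 ((one_lt_div hp).2 hps))
  calc ∑ i ∈ S, b i ^ s
      ≤ ∑ i ∈ S, α ^ (s / p) * (((S.filter fun j => b i ≤ b j).card : ℝ) ^ (s / p))⁻¹ := by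
        refine Finset.sum_le_sum fun i hi => ?_
        rcases (hb i hi).eq_or_lt with h0 | h0
        · rw [← h0, Real.zero_rpow hs.ne']
          positivity
        · have h1 : (0 : ℝ) < (S.filter fun k => b i ≤ b k).card :=
            Nat.cast_pos.2 (Finset.card_pos.2 ⟨i, Finset.mem_filter.2 ⟨hi, le_rfl⟩⟩)
          -- What remains is the hypothesis `bᵢᵖ · rank ≤ α` raised to the power `s / p`.
          rw [← div_eq_mul_inv, le_div_iff₀ (by positivity)]
          calc b i ^ s * ((S.filter fun j => b i ≤ b j).card : ℝ) ^ (s / p)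
              = (b i ^ p * ((S.filter fun j => b i ≤ b j).card : ℝ)) ^ (s / p) := by
                rw [Real.mul_rpow (by positivity) h1.le, ← Real.rpow_mul h0.le]
                congr 2
                field_simp
            _ ≤ α ^ (s / p) := by
                have := h i hi h0
                gcongr
    _ ≤ α ^ (s / p) * ∑ k ∈ Finset.range S.card, (((k + 1 : ℕ) : ℝ) ^ (s / p))⁻¹ := by
        rw [← Finset.mul_sum]
        have := sum_rank_rpow_le b (s := s / p) (by positivity) S
        gcongr
    _ ≤ _ := by
        have := hsum.sum_le_tsum (Finset.range S.card) fun k _ => by positivity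
        gcongr

/-- From `r < q` one gets `1/p + 1/r > 1`, that is `1/r' < 1/p`. Working with inverses in `ℝ≥0∞`
includes `q = ∞`. -/
theorem lt_conjExponent {p r : ℝ} {q : ℝ≥0∞} (hp : 1 ≤ p) (hpq : (ENNReal.ofReal p)⁻¹ + q⁻¹ = 1)
    (hr : 1 < r) (hrq : ENNReal.ofReal r < q) : p < r.conjExponent := by
  have hp0 : 0 < p := by linarith
  have hr0 : 0 < r := by linarith
  have h1 : 1 < (ENNReal.ofReal p)⁻¹ + (ENNReal.ofReal r)⁻¹ := by
    rw [← hpq]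
    refine ENNReal.add_lt_add_left ?_ (ENNReal.inv_lt_inv.2 hrq)
    simpa using hp0
  rw [← ENNReal.ofReal_inv_of_pos hp0, ← ENNReal.ofReal_inv_of_pos hr0,
    ← ENNReal.ofReal_add (by positivity) (by positivity), ENNReal.one_lt_ofReal] at h1
  have h2 : 0 < r - 1 := by linarith
  rw [Real.conjExponent, lt_div_iff₀ h2]
  field_simp at h1
  linarith

end Numerics

/-! ### Restriction of weakly null trees to subtrees. -/

section Trees

variable {X : Type*} [NormedAddCommGroup X] {D : Set (Set X)}

/-- `x` maps the sequences with ordinal coordinates in `S` into the unit ball and is normally weakly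
null on them. -/
structure IsNullTree (D : Set (Set X)) (S : Set (List Ordinal)) (x : List (Ordinal × D) → X) :
    Prop where
  norm_le : ∀ t, t.map Prod.fst ∈ S → ‖x t‖ ≤ 1
  mem : ∀ (s : List (Ordinal × D)) (ζ : Ordinal) (U : D),
    (s ++ [(ζ, U)]).map Prod.fst ∈ S → x (s ++ [(ζ, U)]) ∈ (U : Set X)

variable {S S' : Set (List Ordinal)} {x : List (Ordinal × D) → X}

theorem IsNullTree.mono (hx : IsNullTree D S x) (h : S' ⊆ S) : IsNullTree D S' x :=
  ⟨fun t ht => hx.norm_le t (h ht), fun s ζ U hs => hx.mem s ζ U (h hs)⟩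

theorem IsNullTree.shiftPairs (hx : IsNullTree D S x) (ζ : Ordinal)
    (h : ∀ t ∈ S', t.map (fun η => ζ + η) ∈ S) :
    IsNullTree D S' fun t => x (shiftPairs ζ t) := by
  have h' : ∀ t : List (Ordinal × D), t.map Prod.fst ∈ S' →
      (XiSzlenk.shiftPairs ζ t).map Prod.fst ∈ S := fun t ht => by
    rw [map_fst_shiftPairs]
    exact h _ ht
  refine ⟨fun t ht => hx.norm_le _ (h' t ht), fun s η U hs => ?_⟩
  have := h' _ hs
  rw [XiSzlenk.shiftPairs, List.map_append] at this ⊢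
  exact hx.mem _ _ U this

theorem IsNullTree.append (hx : IsNullTree D S x) (t : List (Ordinal × D))
    (h : ∀ u ∈ S', t.map Prod.fst ++ u ∈ S) : IsNullTree D S' fun u => x (t ++ u) := by
  refine ⟨fun u hu => hx.norm_le _ (by rw [List.map_append]; exact h _ hu), fun s η U hs => ?_⟩
  have := h _ hs
  rw [← List.map_append, ← List.append_assoc] at this
  simp only [← List.append_assoc]
  exact hx.mem _ _ U this

end Trees

/-! ### Estimates on one unit: formulation, the limiting argument and the case `ξ = 0`. -/

section Estimates

variable (𝕜 : Type*) [RCLike 𝕜] {X : Type*} [NormedAddCommGroup X] [NormedSpace 𝕜 X]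

/-- If every maximal member `t` of `Γ_ξ D` has a functional in one of finitely many weak* compact
sets that is large at `e + a z^t`, then one of these sets has a member of a derivative of order
`ω ^ ξ` that is large at `e`, up to `a` times the parameter of the derivation. -/
def UnitEstimate (D : Set (Set X)) (ξ : Ordinal.{w}) : Prop :=
  ∀ (F : Type) [Finite F] (K : F → Set (StrongDual 𝕜 X)) (c : F → ℝ) (e : X) (a : ℝ)
    (x : List (Ordinal.{w} × D) → X), (∀ k, IsWeakStarCompact (K k)) →
    (∀ k, ∀ f ∈ K k, ‖f‖ ≤ 1) → 0 ≤ a → IsNullTree D (Gam ξ) x →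
    (∀ t : List (Ordinal × D), t.map Prod.fst ∈ maxMembers (Gam ξ) →
      ∃ k, ∃ f ∈ K k, c k ≤ RCLike.re (f (e + (a : 𝕜) • unitSum 𝕜 ξ x t))) →
    ∀ δ : ℝ, 0 < δ → ∃ k, ∃ b ∈ Set.Icc (0 : ℝ) 1, ∃ y ∈ szlenkDerivXi ξ b (K k),
      c k - δ ≤ RCLike.re (y e) + a * b

/-- The counterpart of `UnitEstimate` for `Γ_{ξ, n} D` and mixed derivations. -/
def StackEstimate (D : Set (Set X)) (ξ : Ordinal.{w}) (n : ℕ) : Prop :=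
  ∀ (F : Type) [Finite F] (K : F → Set (StrongDual 𝕜 X)) (c : F → ℝ) (e : X) (a : ℕ → ℝ)
    (x : List (Ordinal.{w} × D) → X), (∀ k, IsWeakStarCompact (K k)) →
    (∀ k, ∀ f ∈ K k, ‖f‖ ≤ 1) → (∀ i, 0 ≤ a i) → IsNullTree D (GamN ξ n) x →
    (∀ t : List (Ordinal × D), t.map Prod.fst ∈ maxMembers (GamN ξ n) →
      ∃ k, ∃ f ∈ K k, c k ≤ RCLike.re
        (f (e + ∑ i ∈ Finset.range n, (a i : 𝕜) • convexBlock 𝕜 ξ n x t (i + 1)))) →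
    ∀ δ : ℝ, 0 < δ → ∃ k, ∃ b : ℕ → ℝ, (∀ i, b i ∈ Set.Icc (0 : ℝ) 1) ∧
      ∃ y ∈ mixedDeriv ξ (K k) n b,
        c k - δ ≤ RCLike.re (y e) + ∑ i ∈ Finset.range n, a i * b i

variable {𝕜}

theorem szlenkDerivXi_zero (ξ : Ordinal.{w}) (K : Set (StrongDual 𝕜 X)) :
    szlenkDerivXi ξ 0 K = K := by
  have h : ∀ β : Ordinal.{w}, K ⊆ derivIter (szlenkDeriv 0) K β := fun β => by
    induction β using Ordinal.limitRecOn with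
    | zero => rw [derivIter_zero]
    | add_one β ih => rwa [derivIter_add_one, szlenkDeriv_zero]
    | limit β hβ ih =>
      rw [derivIter_limit _ _ hβ]
      exact Set.subset_iInter₂ ih
  exact Set.Subset.antisymm (szlenkDerivXi_subset ξ 0 K) (h _)

/-- A limit along an ultrafilter of finitely coloured functionals and parameters. -/
theorem exists_limit {F : Type*} [Finite F] {K : F → Set (StrongDual 𝕜 X)} {c : F → ℝ} {e : X}
    {a : ℝ} (hK : ∀ k, IsWeakStarCompact (K k)) (ha : 0 ≤ a) {ι : Type*} (𝒰 : Ultrafilter ι)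
    (κ : ι → F) (β : ι → ℝ) (f : ι → StrongDual 𝕜 X) (hβ : ∀ i, β i ∈ Set.Icc (-1 : ℝ) 1)
    (hf : ∀ i, f i ∈ K (κ i)) (h : ∀ i, c (κ i) ≤ RCLike.re (f i e) + a * β i)
    {δ : ℝ} (hδ : 0 < δ) :
    ∃ k, ∃ b ∈ Set.Icc (0 : ℝ) 1, ∃ y ∈ K k, ∃ β₀,
      (∀ᶠ i in 𝒰, κ i = k) ∧ Filter.Tendsto β 𝒰 (𝓝 β₀) ∧
      Filter.Tendsto (fun i => StrongDual.toWeakDual (f i)) 𝒰 (𝓝 (StrongDual.toWeakDual y)) ∧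
      (b = 0 ∨ b < β₀) ∧ c k - δ ≤ RCLike.re (y e) + a * b := by
  obtain ⟨k, hk⟩ : ∃ k, ∀ᶠ i in 𝒰, κ i = k := by
    obtain ⟨k, hk⟩ := (𝒰.map κ).eq_pure_of_finite
    have : {k} ∈ 𝒰.map κ := by rw [hk]; exact Set.mem_singleton k
    exact ⟨k, this⟩
  obtain ⟨β₀, hβ₀, hlim⟩ := isCompact_Icc.ultrafilter_le_nhds (𝒰.map β)
    (Filter.le_principal_iff.2
      (Filter.Eventually.of_forall hβ : ∀ᶠ i in 𝒰, β i ∈ Set.Icc (-1 : ℝ) 1))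
  obtain ⟨y, hy, hylim⟩ := (hK k).exists_tendsto 𝒰 (hk.mono fun i hi => hi ▸ hf i)
  have hlim' : Filter.Tendsto β 𝒰 (𝓝 β₀) := hlim
  have h1 : c k ≤ RCLike.re (y e) + a * β₀ :=
    ge_of_tendsto ((tendsto_eval hylim e).add (hlim'.const_mul a))
      (hk.mono fun i hi => hi ▸ h i)
  have hη : 0 < δ / (a + 1) := by positivity
  have h2 : a * (δ / (a + 1)) ≤ δ := by
    rw [mul_div_assoc', div_le_iff₀ (by positivity)]
    nlinarith
  -- Derivations need a strict inequality, so the parameter is taken just below the limit `β₀`, at a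
  -- cost of at most `δ`. If that is negative it becomes 0, where the derivation is the identity.
  refine ⟨k, max (β₀ - δ / (a + 1)) 0, ⟨le_max_right _ _, ?_⟩, y, hy, β₀, hk, hlim', hylim,
    ?_, ?_⟩
  · exact max_le ((sub_le_self _ hη.le).trans hβ₀.2) zero_le_one
  · rcases le_total (β₀ - δ / (a + 1)) 0 with h | h
    · exact Or.inl (max_eq_right h)
    · rw [max_eq_left h]
      exact Or.inr (by linarith)
  · have := mul_le_mul_of_nonneg_left (le_max_left (β₀ - δ / (a + 1)) 0) ha
    nlinarith

theorem re_apply_add_smul (f : StrongDual 𝕜 X) (e v : X) (a : ℝ) :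
    RCLike.re (f (e + (a : 𝕜) • v)) = RCLike.re (f e) + a * RCLike.re (f v) := by
  simp

theorem abs_re_apply_le {f : StrongDual 𝕜 X} (hf : ‖f‖ ≤ 1) {v : X} (hv : ‖v‖ ≤ 1) :
    |RCLike.re (f v)| ≤ 1 :=
  (RCLike.abs_re_le_norm _).trans ((f.le_of_opNorm_le hf v).trans (by rwa [one_mul]))

/-- The sets `{U ∈ D : U ⊆ V}`, for weak neighborhoods `V` of 0, generate a proper filter on `D`.
Along any finer ultrafilter, a choice of points `x U ∈ U` is weakly null. -/
theorem IsWeakBasis.exists_ultrafilter {D : Set (Set X)} (hD : IsWeakBasis 𝕜 D) :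
    ∃ 𝒰 : Ultrafilter D, ∀ x : D → X, (∀ U : D, x U ∈ (U : Set X)) →
      ∀ y : StrongDual 𝕜 X, Filter.Tendsto (fun U => RCLike.re (y (x U))) 𝒰 (𝓝 0) := by
  set W : Filter X := Filter.comap (toWeakSpace 𝕜 X) (𝓝 0) with hW
  have hne : (Filter.comap (Subtype.val : D → Set X) W.smallSets).NeBot := by
    rw [Filter.comap_neBot_iff]
    intro T hT
    obtain ⟨V, hV, hVT⟩ := W.hasBasis_smallSets.mem_iff.1 hT
    obtain ⟨U, hU, hUV⟩ := hD.mem_iff.1 hV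
    exact ⟨⟨U, hU⟩, hVT hUV⟩
  refine ⟨Ultrafilter.of (Filter.comap Subtype.val W.smallSets), fun x hx y => ?_⟩
  have h1 : Filter.Tendsto (fun v : X => RCLike.re (y v)) W (𝓝 0) := by
    have h2 : Continuous fun v : WeakSpace 𝕜 X => RCLike.re ((topDualPairing 𝕜 X).flip v y) :=
      RCLike.continuous_re.comp (WeakBilin.eval_continuous (topDualPairing 𝕜 X).flip y)
    have h3 := h2.tendsto 0
    have h4 : RCLike.re ((topDualPairing 𝕜 X).flip (0 : WeakSpace 𝕜 X) y) = 0 := by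
      change RCLike.re (y 0) = 0
      rw [map_zero, map_zero]
    rw [h4] at h3
    exact h3.comp Filter.tendsto_comap
  refine h1.comp (Filter.Tendsto.mono_left (fun V hV => ?_) (Ultrafilter.of_le _))
  exact ⟨𝒫 V, W.hasBasis_smallSets.mem_of_mem hV, fun U hU => hU (hx U)⟩

theorem unitEstimate_zero {D : Set (Set X)} (hD : IsWeakBasis 𝕜 D) :
    UnitEstimate 𝕜 D (0 : Ordinal.{w}) := by
  intro F _ K c e a x hK hK1 ha hx H δ hδ
  have hmax : ∀ U : D, [((0 : Ordinal.{w}), U)].map Prod.fst ∈ maxMembers (Gam 0) := fun U => by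
    rw [Gam_zero]
    exact ⟨rfl, fun s hs _ => hs⟩
  obtain ⟨𝒰, h𝒰⟩ := hD.exists_ultrafilter
  choose κ f hf h using fun U => H _ (hmax U)
  simp only [unitSum_zero, re_apply_add_smul] at h
  have hmem := fun U : D => hx.mem [] 0 U (maxMembers_subset _ (hmax U))
  have hnorm := fun U : D => hx.norm_le _ (maxMembers_subset _ (hmax U))
  obtain ⟨k, b, hb, y, hy, β, hκ, hβ, hlim, hbβ, hle⟩ := exists_limit hK ha 𝒰 κ
    (fun U => RCLike.re (f U (x [(0, U)]))) f
    (fun U => abs_le.1 (abs_re_apply_le (hK1 _ _ (hf U)) (hnorm U))) hf h hδ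
  refine ⟨k, b, hb, y, ?_, hle⟩
  rw [szlenkDerivXi_ord_zero]
  rcases hbβ with rfl | hbβ
  · rwa [szlenkDeriv_zero]
  refine ⟨hy, fun _ V hV => ?_⟩
  -- As `y` is fixed, `y (x_U)` tends to 0, so `re ((f U - y) (x_U))` tends to `β > b`. With `‖x_U‖
  -- ≤ 1` this gives points of `K k` near `y` at distance more than `b` from it.
  have h1 := hβ.sub (h𝒰 _ hmem y)
  rw [sub_zero] at h1
  obtain ⟨U, hU1, hU2, hU3⟩ := ((h1.eventually_const_lt hbβ).and
    ((hlim.eventually_mem hV).and hκ)).exists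
  have hyV : StrongDual.toWeakDual y ∈ V := mem_of_mem_nhds hV
  have hUK : f U ∈ K k := hU3 ▸ hf U
  refine lt_of_lt_of_le ?_ (Metric.edist_le_ediam_of_mem (show f U ∈ _ from ⟨hU2, hUK⟩)
    (show y ∈ _ from ⟨hyV, hy⟩))
  rw [edist_dist, dist_eq_norm]
  refine (ENNReal.ofReal_lt_ofReal_iff_of_nonneg hb.1).2 (hU1.trans_le ?_)
  simp only [List.nil_append]
  calc RCLike.re (f U (x [(0, U)])) - RCLike.re (y (x [(0, U)]))
      = RCLike.re ((f U - y) (x [(0, U)])) := by simp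
    _ ≤ ‖(f U - y) (x [(0, U)])‖ := RCLike.re_le_norm _
    _ ≤ ‖f U - y‖ := (f U - y).unit_le_opNorm _ (hnorm U)

end Estimates

/-! ### Induction over the number of levels and over `ξ`. -/

section Estimates

variable {𝕜 : Type*} [RCLike 𝕜] {X : Type*} [NormedAddCommGroup X] [NormedSpace 𝕜 X]
  {D : Set (Set X)} {ξ : Ordinal.{w}}

theorem stackEstimate_one (h : UnitEstimate 𝕜 D ξ) : StackEstimate 𝕜 D ξ 1 := by
  intro F _ K c e a x hK hK1 ha hx H δ hδ
  rw [GamN_one] at hx H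
  obtain ⟨k, b, hb, y, hy, hle⟩ := h F K c e (a 0) x hK hK1 (ha 0) hx (fun t ht => by
    obtain ⟨k, f, hf, hle⟩ := H t ht
    rw [Finset.sum_range_one, zero_add, convexBlock_one 𝕜 x (maxMembers_subset _ ht)] at hle
    exact ⟨k, f, hf, hle⟩) δ hδ
  exact ⟨k, fun _ => b, fun _ => hb, y, hy, by rwa [Finset.sum_range_one]⟩

/-- Rounding goes down, to multiples of `1/M`, since lowering the parameters enlarges a mixed
derivative. -/
theorem exists_finite_rounding (n : ℕ) {η : ℝ} (hη : 0 < η) :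
    ∃ (V : Type) (_ : Finite V) (g : V → ℕ → ℝ), (∀ v i, g v i ∈ Set.Icc (0 : ℝ) 1) ∧
      ∀ b : ℕ → ℝ, (∀ i, b i ∈ Set.Icc (0 : ℝ) 1) →
        ∃ v, ∀ i < n, g v i ≤ b i ∧ b i ≤ g v i + η := by
  obtain ⟨M, hM⟩ := exists_nat_gt (1 / η)
  have hM1 : (0 : ℝ) < M := (one_div_pos.2 hη).trans hM
  have hMη : 1 / (M : ℝ) ≤ η := (one_div_le hM1 hη).2 hM.le
  refine ⟨Fin n → Fin (M + 1), inferInstance,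
    fun v i => if h : i < n then ((v ⟨i, h⟩ : ℕ) : ℝ) / M else 0, fun v i => ?_, fun b hb => ?_⟩
  · beta_reduce
    split_ifs with hi
    · refine ⟨by positivity, (div_le_one hM1).2 ?_⟩
      exact_mod_cast Nat.lt_add_one_iff.1 (v ⟨i, hi⟩).2
    · simp
  · refine ⟨fun i => ⟨⌊b i * M⌋₊, Nat.lt_add_one_iff.2 (Nat.floor_le_of_le ?_)⟩, fun i hi => ?_⟩
    · exact mul_le_of_le_one_left hM1.le (hb i).2
    · simp only [dif_pos hi]
      refine ⟨(div_le_iff₀ hM1).2 (Nat.floor_le (mul_nonneg (hb i).1 hM1.le)), ?_⟩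
      refine le_trans ?_ (add_le_add_right hMη _)
      rw [← add_div]
      exact (le_div_iff₀ hM1).2 (Nat.lt_floor_add_one _).le

/-- For a fixed maximal first unit `t`, the estimate for `n` levels is applied with its block
absorbed into the base vector. The resulting parameters depend on `t`. After rounding, finitely many
mixed derivatives serve all `t`, and `UnitEstimate` applies to these. -/
theorem stackEstimate_add_one (h : UnitEstimate 𝕜 D ξ) {n : ℕ} (hn : StackEstimate 𝕜 D ξ n) :
    StackEstimate 𝕜 D ξ (n + 1) := by
  intro F _ K c e a x hK hK1 ha hx H δ hδ
  set A := ∑ i ∈ Finset.range n, a (i + 1) with hA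
  have hA0 : 0 ≤ A := Finset.sum_nonneg fun i _ => ha _
  -- The error `δ` is split in three: later levels, rounding, first level. The `+ 1` covers `A = 0`.
  obtain ⟨V, _, g, hg01, hround⟩ := exists_finite_rounding n (η := δ / 3 / (A + 1)) (by positivity)
  have hAη : A * (δ / 3 / (A + 1)) ≤ δ / 3 := by
    rw [mul_div_assoc', div_le_iff₀ (by positivity)]
    nlinarith
  have key : ∀ t : List (Ordinal × D), t.map Prod.fst ∈ maxMembers (Gam ξ) →
      ∃ kv : F × V, ∃ f ∈ mixedDeriv ξ (K kv.1) n (g kv.2),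
        c kv.1 - 2 * δ / 3 - ∑ i ∈ Finset.range n, a (i + 1) * g kv.2 i ≤ RCLike.re (f (e +
          (a 0 : 𝕜) • unitSum 𝕜 ξ (fun s => x (shiftPairs (Ordinal.omega0 ^ ξ * n) s)) t)) := by
    intro t ht
    have hH : ∀ u : List (Ordinal × D), u.map Prod.fst ∈ maxMembers (GamN ξ n) →
        ∃ k, ∃ f ∈ K k, c k ≤ RCLike.re (f ((e + (a 0 : 𝕜) • unitSum 𝕜 ξ
          (fun s => x (shiftPairs (Ordinal.omega0 ^ ξ * n) s)) t) +
            ∑ i ∈ Finset.range n, (a (i + 1) : 𝕜) • convexBlock 𝕜 ξ n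
              (fun u => x (shiftPairs (Ordinal.omega0 ^ ξ * n) t ++ u)) u (i + 1))) := by
      intro u hu
      have hmax : (shiftPairs (Ordinal.omega0 ^ ξ * n) t ++ u).map Prod.fst ∈
          maxMembers (GamN ξ (n + 1)) := by
        rw [List.map_append, map_fst_shiftPairs]
        exact append_mem_maxMembers_GamN ht hu
      obtain ⟨k, f, hf, hle⟩ := H _ hmax
      refine ⟨k, f, hf, ?_⟩
      rw [Finset.sum_range_succ', convexBlock_append 𝕜 x 0 ht (maxMembers_subset _ hu), if_pos rfl,
        convexBlock_zero, add_zero, Finset.sum_congr rfl fun i _ => by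
          rw [convexBlock_append 𝕜 x (i + 1) ht (maxMembers_subset _ hu),
            if_neg (Nat.succ_ne_zero i), zero_add]] at hle
      rwa [add_assoc, add_comm ((a 0 : 𝕜) • _)]
    have hx' : IsNullTree D (GamN ξ n)
        fun u => x (shiftPairs (Ordinal.omega0 ^ ξ * n) t ++ u) :=
      hx.append _ fun u hu => by
        rw [map_fst_shiftPairs]
        exact mem_GamN_add_one.2 (Or.inr ⟨_, ht, u, hu, rfl⟩)
    obtain ⟨k, b, hb, y, hy, hle⟩ := hn F K c _ (fun i => a (i + 1)) _ hK hK1 (fun i => ha _)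
      hx' hH (δ / 3) (by positivity)
    obtain ⟨v, hv⟩ := hround b hb
    refine ⟨(k, v), y, mixedDeriv_anti ξ (K k) n _ _ (fun i hi => (hv i hi).1) hy, ?_⟩
    have h1 : ∑ i ∈ Finset.range n, a (i + 1) * b i ≤
        ∑ i ∈ Finset.range n, a (i + 1) * g v i + A * (δ / 3 / (A + 1)) := by
      rw [Finset.sum_mul, ← Finset.sum_add_distrib]
      refine Finset.sum_le_sum fun i hi => ?_
      rw [← mul_add]
      exact mul_le_mul_of_nonneg_left (hv i (Finset.mem_range.1 hi)).2 (ha (i + 1))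
    simp only
    linarith
  obtain ⟨⟨k, v⟩, b, hb, y, hy, hle⟩ := h (F × V)
    (fun kv => mixedDeriv ξ (K kv.1) n (g kv.2))
    (fun kv => c kv.1 - 2 * δ / 3 - ∑ i ∈ Finset.range n, a (i + 1) * g kv.2 i) e (a 0)
    (fun s => x (shiftPairs (Ordinal.omega0 ^ ξ * n) s)) (fun kv => (hK _).mixedDeriv ξ n _)
    (fun kv f hf => hK1 _ f (mixedDeriv_subset _ _ _ _ hf)) (ha 0)
    (hx.shiftPairs _ fun t ht => mem_GamN_add_one.2 (Or.inl ⟨t, ht, rfl⟩)) key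
    (δ / 3) (by positivity)
  -- The first level is removed last, so its parameter `b` belongs to the outermost derivation and
  -- comes first.
  let B : ℕ → ℝ := fun i => Nat.casesOn i b (g v)
  have hy' : y ∈ mixedDeriv ξ (K k) (n + 1) B := hy
  refine ⟨k, B, fun i => ?_, y, hy', ?_⟩
  · cases i with
    | zero => exact hb
    | succ i => exact hg01 v i
  · rw [Finset.sum_range_succ', show B 0 = b from rfl]
    simp only [show ∀ i, B (i + 1) = g v i from fun _ => rfl] at hle ⊢
    linarith

/-- The induction starts at one level: `Γ_{ξ, 0}` is empty, and the hypothesis on its maximal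
members would be vacuous. -/
theorem stackEstimate (h : UnitEstimate 𝕜 D ξ) (n : ℕ) : StackEstimate 𝕜 D ξ (n + 1) := by
  induction n with
  | zero => exact stackEstimate_one h
  | succ n ih => exact stackEstimate_add_one h ih

/-- On `Γ_{ξ, m+1}` the unit sum is the average of `m + 1` blocks, so the stack estimate with
coefficients `a / (m + 1)` produces an average of parameters. A limit in `m` makes the number of
large parameters exceed every `N`. -/
theorem unitEstimate_add_one (h : UnitEstimate 𝕜 D ξ) : UnitEstimate 𝕜 D (ξ + 1) := by
  intro F _ K c e a x hK hK1 ha hx H δ hδ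
  have hsub : ∀ n, GamN ξ n ⊆ Gam (ξ + 1) := fun n => by
    rw [Gam_add_one]
    exact Set.subset_iUnion _ n
  have key : ∀ m : ℕ, ∃ k, ∃ b : ℕ → ℝ, (∀ i, b i ∈ Set.Icc (0 : ℝ) 1) ∧
      ∃ y ∈ mixedDeriv ξ (K k) (m + 1) b, c k - δ / 2 ≤ RCLike.re (y e) +
        ∑ i ∈ Finset.range (m + 1), a / (m + 1 : ℕ) * b i := fun m =>
    stackEstimate h m F K c e (fun _ => a / (m + 1 : ℕ)) x hK hK1 (fun _ => by positivity)
      (hx.mono (hsub _)) (fun t ht => by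
        obtain ⟨k, f, hf, hle⟩ := H t (mem_maxMembers_Gam_add_one ht)
        refine ⟨k, f, hf, ?_⟩
        rw [unitSum_add_one 𝕜 x (maxMembers_subset _ ht), smul_smul, Finset.smul_sum,
          ← RCLike.ofReal_mul, mul_one_div] at hle
        exact hle) (δ / 2) (by positivity)
  choose κ b hb y hy hle using key
  set mean : ℕ → ℝ := fun m => (∑ i ∈ Finset.range (m + 1), b m i) / (m + 1 : ℕ) with hmean
  have hmean01 : ∀ m, mean m ∈ Set.Icc (-1 : ℝ) 1 := by
    intro m
    have h0 : 0 ≤ mean m := div_nonneg (Finset.sum_nonneg fun i _ => (hb m i).1) (by positivity)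
    refine ⟨by linarith, (div_le_one (by positivity)).2 ?_⟩
    calc ∑ i ∈ Finset.range (m + 1), b m i ≤ ∑ i ∈ Finset.range (m + 1), (1 : ℝ) :=
          Finset.sum_le_sum fun i _ => (hb m i).2
      _ = _ := by simp
  obtain ⟨k, b₀, hb₀, z, hz, β, hκ, hβ, hlim, hbβ, hfin⟩ := exists_limit hK ha
    (c := fun k => c k - δ / 2) (e := e) (Filter.hyperfilter ℕ) κ mean y hmean01
    (fun m => mixedDeriv_subset _ _ _ _ (hy m))
    (fun m => by
      refine (hle m).trans_eq ?_
      rw [← Finset.mul_sum, hmean]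
      ring) (half_pos hδ)
  refine ⟨k, b₀, hb₀, z, ?_, by linarith⟩
  rcases hbβ with rfl | hbβ
  · rwa [szlenkDerivXi_zero]
  refine mem_szlenkDerivXi_add_one fun N => ?_
  refine ((hK k).iterate_szlenkDerivXi ξ b₀ N).mem_of_tendsto ?_ hlim
  have hη : 0 < (β - b₀) / 2 := by linarith
  -- For `m ≥ N'` with `mean m` past the midpoint of `b₀` and `β`, the excess `(m + 1) * (mean m -
  -- b₀)` is more than `N`.
  obtain ⟨N', hN'⟩ := exists_nat_gt (N / ((β - b₀) / 2))
  have hge : ∀ᶠ m : ℕ in (Filter.hyperfilter ℕ : Filter ℕ), N' ≤ m :=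
    (Filter.eventually_ge_atTop N').filter_mono
      (Nat.cofinite_eq_atTop ▸ Filter.hyperfilter_le_cofinite)
  filter_upwards [hκ, hge, hβ.eventually_const_lt (show b₀ + (β - b₀) / 2 < β by linarith)]
    with m hm1 hm2 hm3
  refine iterate_szlenkDerivXi_anti ξ b₀ (K k) ?_
    (mixedDeriv_subset_iterate ξ (K k) b₀ (m + 1) (b m) (hm1 ▸ hy m))
  -- A parameter is at most 1 if it is at least `b₀`, and below `b₀` otherwise. The excess of the
  -- sum over `(m + 1) * b₀` therefore bounds the number of large parameters from below.
  have hcount : ∑ i ∈ Finset.range (m + 1), b m i ≤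
      ((Finset.range (m + 1)).filter fun i => b₀ ≤ b m i).card + (m + 1 : ℕ) * b₀ := by
    calc ∑ i ∈ Finset.range (m + 1), b m i
        ≤ ∑ i ∈ Finset.range (m + 1), ((if b₀ ≤ b m i then (1 : ℝ) else 0) + b₀) := by
          refine Finset.sum_le_sum fun i _ => ?_
          split_ifs with hi
          · linarith [(hb m i).2, hb₀.1]
          · linarith
      _ = _ := by simp [Finset.sum_add_distrib]
  have hm4 : (N' : ℝ) ≤ (m + 1 : ℕ) := by exact_mod_cast hm2.trans (Nat.le_succ m)
  have hm0 : (0 : ℝ) < (m + 1 : ℕ) := by positivity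
  rw [hmean, lt_div_iff₀ hm0] at hm3
  rw [div_lt_iff₀ hη] at hN'
  have hm5 := mul_le_mul_of_nonneg_right hm4 hη.le
  have : (N : ℝ) ≤ ((Finset.range (m + 1)).filter fun i => b₀ ≤ b m i).card := by
    nlinarith
  exact_mod_cast this

/-- Each subtree `ω ^ ζ + Γ_{ζ+1}` yields a functional in a derivative of order `ω ^ (ζ+1)`. For
each fixed `ζ`, those with larger index eventually lie in the compact set `s_{ζ, b₀}(K k)`, and so
does their limit. -/
theorem unitEstimate_limit (hξ : Order.IsSuccLimit ξ)
    (h : ∀ ζ < ξ, UnitEstimate 𝕜 D (ζ + 1)) : UnitEstimate 𝕜 D ξ := by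
  intro F _ K c e a x hK hK1 ha hx H δ hδ
  have key : ∀ ζ : Set.Iio ξ, ∃ k, ∃ b ∈ Set.Icc (0 : ℝ) 1,
      ∃ y ∈ szlenkDerivXi (ζ.1 + 1) b (K k), c k - δ / 2 ≤ RCLike.re (y e) + a * b := fun ζ =>
    h ζ ζ.2 F K c e a (fun s => x (shiftPairs (Ordinal.omega0 ^ ζ.1) s)) hK hK1 ha
      (hx.shiftPairs _ fun t ht => by
        rw [Gam_limit hξ]
        exact Set.mem_iUnion₂.2 ⟨ζ.1, ζ.2, t, ht, rfl⟩)
      (fun t ht => by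
        have hmax : (shiftPairs (Ordinal.omega0 ^ ζ.1) t).map Prod.fst ∈ maxMembers (Gam ξ) := by
          rw [map_fst_shiftPairs]
          exact shift_mem_maxMembers_Gam hξ ζ.2 ht
        obtain ⟨k, f, hf, hle⟩ := H _ hmax
        rw [unitSum_limit 𝕜 hξ ζ.2 x (maxMembers_subset _ ht)] at hle
        exact ⟨k, f, hf, hle⟩) (δ / 2) (half_pos hδ)
  choose κ b hb y hy hle using key
  have : Nonempty (Set.Iio ξ) := ⟨⟨0, hξ.bot_lt⟩⟩
  obtain ⟨k, b₀, hb₀, z, hz, β, hκ, hβ, hlim, hbβ, hfin⟩ := exists_limit hK ha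
    (c := fun k => c k - δ / 2) (e := e) (Ultrafilter.of (Filter.atTop : Filter (Set.Iio ξ))) κ b y
    (fun ζ => ⟨by linarith [(hb ζ).1], (hb ζ).2⟩)
    (fun ζ => szlenkDerivXi_subset _ _ _ (hy ζ)) hle (half_pos hδ)
  refine ⟨k, b₀, hb₀, z, ?_, by linarith⟩
  rcases hbβ with rfl | hbβ
  · rwa [szlenkDerivXi_zero]
  refine mem_szlenkDerivXi_limit hξ fun ζ hζ => ?_
  refine ((hK k).szlenkDerivXi ζ b₀).mem_of_tendsto ?_ hlim
  filter_upwards [hκ, hβ.eventually_const_lt hbβ,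
    (Filter.eventually_ge_atTop (⟨ζ, hζ⟩ : Set.Iio ξ)).filter_mono (Ultrafilter.of_le _)]
    with η h1 h2 h3
  have h4 : ζ ≤ η.1 + 1 := (show ζ ≤ η.1 from h3).trans le_self_add
  exact szlenkDerivXi_anti h4 b₀ (K k) (szlenkDerivXi_mono _ h2.le subset_rfl (h1 ▸ hy η))

theorem unitEstimate (hD : IsWeakBasis 𝕜 D) (ξ : Ordinal.{w}) : UnitEstimate 𝕜 D ξ := by
  induction ξ using Ordinal.limitRecOn with
  | zero => exact unitEstimate_zero hD
  | add_one ξ ih => exact unitEstimate_add_one ih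
  | limit ξ hξ ih => exact unitEstimate_limit hξ fun ζ hζ => ih _ (hξ.add_one_lt hζ)

end Estimates

/-! ### The Szlenk power bound and Hölder's inequality. -/

section Bounds

variable {𝕜 : Type*} [RCLike 𝕜] {X Y : Type*} [NormedAddCommGroup X] [NormedSpace 𝕜 X]
  [NormedAddCommGroup Y] [NormedSpace 𝕜 Y]

/-- If `N` of the parameters are at least `ε`, the `N`-th iterate of `s_{ξ, ε}` is nonempty, so `N ≤
Sz_ξ(A, ε)`. -/
theorem rpow_mul_card_le {p : ℝ} {ξ : Ordinal.{w}} {A : X →L[𝕜] Y} {α : ℝ≥0}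
    (hα : szlenkPowerSup p ξ A = α) {n : ℕ} {b : ℕ → ℝ}
    (hb : (mixedDeriv ξ (adjointBall A) n b).Nonempty) {ε : ℝ} (hε : ε ∈ Set.Ioc (0 : ℝ) 1) :
    ε ^ p * ((Finset.range n).filter fun i => ε ≤ b i).card ≤ α := by
  have h1 := natCast_le_toENN_szlenkXi (hb.mono (mixedDeriv_subset_iterate ξ _ ε n b))
  have h2 : ENNReal.ofReal (ε ^ p) * toENN (szlenkXi ξ (adjointBall A) ε) ≤ α := by
    rw [← hα]
    exact le_iSup₂ (f := fun ε (_ : ε ∈ Set.Ioc (0 : ℝ) 1) =>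
      ENNReal.ofReal (ε ^ p) * toENN (szlenkXi ξ (adjointBall A) ε)) ε hε
  have h3 := (mul_le_mul_right h1 (ENNReal.ofReal (ε ^ p))).trans h2
  rw [← ENNReal.ofReal_natCast, ← ENNReal.ofReal_mul (Real.rpow_nonneg hε.1.le _),
    ← ENNReal.ofReal_coe_nnreal] at h3
  exact (ENNReal.ofReal_le_ofReal_iff α.2).1 h3

theorem mem_maxMembers_Om {ξ : Ordinal} {n : ℕ} {D : Type*} {t : List (Ordinal × D)}
    (ht : t.map Prod.fst ∈ maxMembers (GamN ξ n)) : t ∈ maxMembers (Om ξ n D) := by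
  refine ⟨ht.1, fun s hs hts => (hts.eq_of_length ?_).symm⟩
  simpa using (congrArg List.length (ht.2 _ hs (hts.map _))).symm

theorem isNullTree_of_normallyWeaklyNull {D : Set (Set X)} {ξ : Ordinal} {n : ℕ}
    {x : List (Ordinal × D) → X} (h : ∀ t ∈ Om ξ n D, ‖x t‖ ≤ 1)
    (hx : NormallyWeaklyNull D ξ n x) : IsNullTree D (GamN ξ n) x := ⟨h, hx⟩

/-- The constant of the upper `ℓ_r` estimate. -/
noncomputable def upperConst (p r : ℝ) (α : ℝ≥0) : ℝ :=
  ((α : ℝ) ^ (r.conjExponent / p) *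
    ∑' k : ℕ, (((k + 1 : ℕ) : ℝ) ^ (r.conjExponent / p))⁻¹) ^ (1 / r.conjExponent)

theorem sum_mul_le_upperConst {p r : ℝ} (hp : 1 ≤ p) (hr : 1 < r) (hpr : p < r.conjExponent)
    {ξ : Ordinal.{w}} {A : X →L[𝕜] Y} {α : ℝ≥0} (hα : szlenkPowerSup p ξ A = α) {n : ℕ}
    {a b : ℕ → ℝ} (ha : ∀ i, 0 ≤ a i) (hb01 : ∀ i, b i ∈ Set.Icc (0 : ℝ) 1)
    (hb : (mixedDeriv ξ (adjointBall A) n b).Nonempty) :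
    ∑ i ∈ Finset.range n, a i * b i ≤
      upperConst p r α * (∑ i ∈ Finset.range n, a i ^ r) ^ (1 / r) := by
  have h1 := Real.inner_le_Lp_mul_Lq_of_nonneg (Finset.range n)
    (Real.HolderConjugate.conjExponent hr) (fun i _ => ha i) (fun i _ => (hb01 i).1)
  have h2 := sum_rpow_le_of_card_le (by linarith) hpr α.2 (Finset.range n) b
    (fun i _ => (hb01 i).1) (fun i _ hi => rpow_mul_card_le hα hb ⟨hi, (hb01 i).2⟩)
  have hs : 0 < r.conjExponent := by linarith
  refine h1.trans ?_
  rw [mul_comm]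
  refine mul_le_mul_of_nonneg_right ?_
    (Real.rpow_nonneg (Finset.sum_nonneg fun i _ => Real.rpow_nonneg (ha i) _) _)
  exact Real.rpow_le_rpow (Finset.sum_nonneg fun i _ => Real.rpow_nonneg (hb01 i).1 _) h2
    (by positivity)

end Bounds

end XiSzlenk

/-! ### The upper `ℓ_r` estimate. -/

theorem mainTheorem6 (p : ℝ) (q : ℝ≥0∞) (r : ℝ) (hp : 1 ≤ p)
    (hpq : (ENNReal.ofReal p)⁻¹ + q⁻¹ = 1) (hr : 1 < r) (hrq : ENNReal.ofReal r < q) (α : ℝ≥0) :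
    ∃ β : ℝ, ∀ (𝕜 : Type*) [RCLike 𝕜]
      (X : Type*) [NormedAddCommGroup X] [NormedSpace 𝕜 X] [CompleteSpace X]
      (Y : Type*) [NormedAddCommGroup Y] [NormedSpace 𝕜 Y] [CompleteSpace Y]
      (ξ : Ordinal) (A : X →L[𝕜] Y), ‖A‖ ≤ 1 → XiSzlenk.szlenkPowerSup p ξ A = α →
      ∀ D : Set (Set X), XiSzlenk.IsWeakBasis 𝕜 D →
      ∀ n : ℕ, 1 ≤ n → ∀ a : Fin n → ℝ, (∀ i, 0 < a i) →
      ∀ x : List (Ordinal × D) → X, (∀ t ∈ XiSzlenk.Om ξ n D, ‖x t‖ ≤ 1) →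
        XiSzlenk.NormallyWeaklyNull D ξ n x →
        ⨅ t : XiSzlenk.maxMembers (XiSzlenk.Om ξ n D),
            ‖∑ i : Fin n, (a i : 𝕜) • A (XiSzlenk.convexBlock 𝕜 ξ n x t (i + 1))‖
          ≤ β * (∑ i, a i ^ r) ^ (1 / r) := by
  refine ⟨XiSzlenk.upperConst p r α, ?_⟩
  intro 𝕜 _ X _ _ _ Y _ _ _ ξ A hA hα D hD n hn a ha x hx1 hx
  by_contra! hlt
  set R := XiSzlenk.upperConst p r α * (∑ i, a i ^ r) ^ (1 / r) with hR
  set I := ⨅ t : XiSzlenk.maxMembers (XiSzlenk.Om ξ n D),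
    ‖∑ i : Fin n, (a i : 𝕜) • A (XiSzlenk.convexBlock 𝕜 ξ n x t (i + 1))‖ with hI
  obtain ⟨m, rfl⟩ : ∃ m, n = m + 1 := ⟨n - 1, by omega⟩
  let a' : ℕ → ℝ := fun i => if h : i < m + 1 then a ⟨i, h⟩ else 0
  have ha' : ∀ i : Fin (m + 1), a' i = a i := fun i => dif_pos i.2
  have ha'0 : ∀ i, 0 ≤ a' i := fun i => by
    by_cases h : i < m + 1
    · exact (ha' ⟨i, h⟩).symm ▸ (ha _).le
    · exact (dif_neg h : a' i = 0).ge
  -- One compact set suffices here, with base vector 0, so that only `∑ aᵢ bᵢ` remains on the right.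
  obtain ⟨-, b, hb01, y, hy, hle⟩ := XiSzlenk.stackEstimate (XiSzlenk.unitEstimate hD ξ) m Unit
    (fun _ => XiSzlenk.adjointBall A) (fun _ => I) 0 a' x
    (fun _ => XiSzlenk.isWeakStarCompact_adjointBall A)
    (fun _ _ => XiSzlenk.norm_le_of_mem_adjointBall hA) ha'0
    (XiSzlenk.isNullTree_of_normallyWeaklyNull hx1 hx)
    (fun t ht => by
      obtain ⟨g, hg1, hg⟩ := exists_dual_vector'' 𝕜
        (∑ i : Fin (m + 1), (a i : 𝕜) • A (XiSzlenk.convexBlock 𝕜 ξ (m + 1) x t (i + 1)))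
      refine ⟨(), g.comp A, ⟨g, hg1, rfl⟩, ?_⟩
      have h1 : A (0 + ∑ i ∈ Finset.range (m + 1),
          (a' i : 𝕜) • XiSzlenk.convexBlock 𝕜 ξ (m + 1) x t (i + 1)) =
          ∑ i : Fin (m + 1), (a i : 𝕜) • A (XiSzlenk.convexBlock 𝕜 ξ (m + 1) x t (i + 1)) := by
        rw [zero_add, map_sum, Finset.sum_range]
        simp only [ha', map_smul]
      rw [ContinuousLinearMap.comp_apply, h1, hg, RCLike.ofReal_re]
      refine ciInf_le ⟨0, ?_⟩ (⟨t, XiSzlenk.mem_maxMembers_Om ht⟩ :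
        XiSzlenk.maxMembers (XiSzlenk.Om ξ (m + 1) D))
      rintro _ ⟨t, rfl⟩
      exact norm_nonneg _)
    -- This error leaves `(I + R) / 2 ≤ ∑ aᵢ bᵢ`, which contradicts `∑ aᵢ bᵢ ≤ R < I`.
    ((I - R) / 2) (by linarith)
  have h2 := XiSzlenk.sum_mul_le_upperConst hp hr (XiSzlenk.lt_conjExponent hp hpq hr hrq) hα ha'0
    hb01 ⟨y, hy⟩
  have h3 : ∑ i ∈ Finset.range (m + 1), a' i ^ r = ∑ i, a i ^ r := by
    rw [Finset.sum_range]
    simp only [ha']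
  rw [h3, ← hR] at h2
  rw [map_zero, map_zero, zero_add] at hle
  linarith
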